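/- A piston of mass $M=\varepsilon^{-2}$ moves without friction in a container $[0,L]$, $L>0$. To its left there are $m$ and to its right $n$ point particles of mass $1$. All bodies move freely except for elastic collisions of the particles with the container walls and with the piston; the particles do not interact with each other. Let $X$ be the position of the piston and $P=M\dot X$ its momentum, let $x_{l,i}\in[0,X]$, $p_{l,i}$ ($i\le m$) and $x_{r,j}\in[X,L]$, $p_{r,j}$ ($j\le n$) be the positions and momenta of the particles (positions are distances from the left wall, the thickness of the piston being subtracted), and let $$I_{l,i}=\frac{|p_{l,i}|\,X}{\pi},\qquad I_{r,j}=\frac{|p_{r,j}|\,(L-X)}{\pi}$$ be the action variables. A motion is considered as long as no two particles are in contact with the piston at the same moment. For all $m,n$, $L>0$, $T>0$, $a>0$ and $b$ there are $\varepsilon_0>0$ and $C>0$, depending only on these data, such that the following holds for every $0<\varepsilon<\varepsilon_0$ and every initial state with $0<X(0)<L$, $a\le X(0)\le L-a$, $|\varepsilon P(0)|\le b$, $a\le\sum_i p_{l,i}(0)^2\le b$ and $a\le\sum_j p_{r,j}(0)^2\le b$. Put $I_{\Sigma,l}^2=\sum_i I_{l,i}(0)^2$, $I_{\Sigma,r}^2=\sum_j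 I_{r,j}(0)^2$ (initial values of the actions, frozen) and $$H(P,X)=\varepsilon^2\frac{P^2}{2}+\frac{\pi^2 I_{\Sigma,l}^2}{2X^2}+\frac{\pi^2 I_{\Sigma,r}^2}{2(L-X)^2}.$$ The Hamiltonian system $\dot{\bar X}=\partial H/\partial P$, $\dot{\bar P}=-\partial H/\partial X$, evaluated at $(\bar P,\bar X)$, with $\bar X(0)=X(0)$, $\bar P(0)=P(0)$ has a solution with $0<\bar X<L$ on $[0,T/\varepsilon]$, and whenever $0\le s\le T/\varepsilon$, $(X,P,\dots)$ is a motion of the exact system on $[0,s]$ with the given initial state, and $(\bar P,\bar X)$ is such a solution on $[0,s]$, then $$|\varepsilon P(t)-\varepsilon\bar P(t)|\le C\varepsilon,\qquad |X(t)-\bar X(t)|\le C\varepsilon\qquad(0\le t\le s).$$ In particular ($m=n=1$) for one particle on each side the averaged Hamiltonian is $\varepsilon^2P^2/2+\pi^2I_l^2/(2X^2)+\pi^2I_r^2/(2(L-X)^2)$. -/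

import Mathlib

open Set Filter Topology

noncomputable section

/-- State of the container `[0, L]` with a massive piston at `X` (momentum `P`), `m` light particles
to the left of the piston and `n` to the right. Light particles have mass `1`, so their momenta are
their velocities. All positions are distances from the left wall; the thickness of the piston is
subtracted. -/
@[ext]
structure PistonState (m n : ℕ) where
  X : ℝ
  P : ℝ
  xl : Fin m → ℝ
  pl : Fin m → ℝ
  xr : Fin n → ℝ
  pr : Fin n → ℝ

namespace PistonState

variable {m n : ℕ}

/-- The particles are on their sides of the piston, inside the container. -/
def Admissible (L : ℝ) (z : PistonState m n) : Prop :=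
  0 < z.X ∧ z.X < L ∧ (∀ i, 0 ≤ z.xl i ∧ z.xl i ≤ z.X) ∧ (∀ j, z.X ≤ z.xr j ∧ z.xr j ≤ L)

/-- Free motion during time `u`; the piston has mass `M`, hence velocity `P / M`. -/
def free (M u : ℝ) (z : PistonState m n) : PistonState m n where
  X := z.X + u * (z.P / M)
  P := z.P
  xl := fun i => z.xl i + u * z.pl i
  pl := z.pl
  xr := fun j => z.xr j + u * z.pr j
  pr := z.pr

/-- Momentum transferred in an elastic collision from a body of mass `1` with velocity `v`
to a body of mass `M` with velocity `V`: the new velocities are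
`V' = V + 2 / (M + 1) * (v - V)` and `v' = 2 * V - v + 2 / (M + 1) * (v - V)`. -/
def transfer (M V v : ℝ) : ℝ := 2 * M / (M + 1) * (v - V)

/-- The left particle `i` is about to hit the piston. -/
def HitsLeft (M : ℝ) (z : PistonState m n) (i : Fin m) : Prop :=
  z.xl i = z.X ∧ z.P / M < z.pl i

/-- The right particle `j` is about to hit the piston. -/
def HitsRight (M : ℝ) (z : PistonState m n) (j : Fin n) : Prop :=
  z.xr j = z.X ∧ z.pr j < z.P / M

open Classical in
/-- The state just after the instant at which the state just before is `z`: elastic reflections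
from the two walls, and an elastic collision with the piston (used only when at most one particle
touches the piston). If nothing collides, the state is unchanged. -/
def impact (M L : ℝ) (z : PistonState m n) : PistonState m n where
  X := z.X
  P := z.P + (∑ i, if HitsLeft M z i then transfer M (z.P / M) (z.pl i) else 0)
        + ∑ j, if HitsRight M z j then transfer M (z.P / M) (z.pr j) else 0
  xl := z.xl
  pl := fun i =>
    if z.xl i = 0 ∧ z.pl i < 0 then -z.pl i
    else if HitsLeft M z i then z.pl i - transfer M (z.P / M) (z.pl i)
    else z.pl i
  xr := z.xr
  pr := fun j =>
    if z.xr j = L ∧ 0 < z.pr j then -z.pr j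
    else if HitsRight M z j then z.pr j - transfer M (z.P / M) (z.pr j)
    else z.pr j

/-- At most one particle touches the piston. -/
def AtMostOneContact (z : PistonState m n) : Prop :=
  {k : Fin m ⊕ Fin n | Sum.elim z.xl z.xr k = z.X}.Subsingleton

/-- `z` is a motion on the time interval `[0, s]` of the system of a piston of mass `M` and light
particles in `[0, L]`, without simultaneous collisions of two particles with the piston. At the
instant of a collision `z t` is the state prior to the collision. Each instant has a right and a
left neighbourhood in which the motion is free; hence there are finitely many collisions. -/
structure IsMotion (M L s : ℝ) (z : ℝ → PistonState m n) : Prop where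
  admissible : ∀ t ∈ Icc 0 s, (z t).Admissible L
  no_simultaneous : ∀ t ∈ Ico 0 s, (z t).AtMostOneContact
  after : ∀ t ∈ Ico 0 s, ∀ᶠ u in 𝓝[>] t, z u = ((z t).impact M L).free M (u - t)
  before : ∀ t ∈ Ioc 0 s, ∀ᶠ u in 𝓝[<] t, z t = (z u).free M (t - u)

/-- The action variable `|p| X / π` of a left particle. -/
def actionLeft (z : PistonState m n) (i : Fin m) : ℝ := |z.pl i| * z.X / Real.pi

/-- The action variable `|p| (L - X) / π` of a right particle. -/
def actionRight (L : ℝ) (z : PistonState m n) (j : Fin n) : ℝ :=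
  |z.pr j| * (L - z.X) / Real.pi

end PistonState

/-- The averaged Hamiltonian of the piston; `A` and `B` are the sums of the squared actions of the
left and of the right particles. -/
def averagedHamiltonian (ε L A B P X : ℝ) : ℝ :=
  ε ^ 2 * P ^ 2 / 2 + Real.pi ^ 2 * A / (2 * X ^ 2) + Real.pi ^ 2 * B / (2 * (L - X) ^ 2)

/-- `(P, X)` solves on `[0, s]` the Hamiltonian system `X' = ∂H/∂P`, `P' = -∂H/∂X` with the averaged
Hamiltonian and constant `A`, `B`, the piston staying strictly between the walls. -/
structure IsAveragedMotion (ε L A B s : ℝ) (P X : ℝ → ℝ) : Prop where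
  mem : ∀ t ∈ Icc 0 s, X t ∈ Ioo 0 L
  hasDeriv_X : ∀ t ∈ Icc 0 s,
    HasDerivWithinAt X (deriv (fun p => averagedHamiltonian ε L A B p (X t)) (P t)) (Icc 0 s) t
  hasDeriv_P : ∀ t ∈ Icc 0 s,
    HasDerivWithinAt P (-deriv (fun x => averagedHamiltonian ε L A B (P t) x) (X t)) (Icc 0 s) t

end

/-!
The momentum of the piston jumps by an amount of order one at every collision, but
`P + ∑ p_l x_l / X + ∑ p_r (L - x_r) / (L - X)` does not: it is continuous along a motion, differs
from `P` by a bounded amount, and its rate of change is the averaged force up to errors of order `ε`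
as soon as the adiabatic invariants are nearly constant. The invariant `∑ (p X - x V) ^ 2` of the
left side, where `V` is the velocity of the piston, is exactly constant in free flight and under
reflections from the wall, and a particle which hits the piston does not change its own term, since
the collision reverses the relative velocity `p - V`. The other terms change only through the jumps
of `V`, hence by at most a constant times `1 / M` times the total variation of `P`; the right side
is the mirror image. The total variation of `P` grows at most linearly in time:
the virial `∑ p_l x_l / X - ∑ p_r (L - x_r) / (L - X)` is bounded, has bounded derivative in free
flight, and drops at every collision with the piston by at least the transferred momentum. So the
invariants drift by `O(ε)` up to the time `T / ε`. They keep the piston away from the walls by a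
continuity argument, and Grönwall's inequality compares the corrected slow variables with the
averaged motion.
-/

noncomputable section

/-! ### Real functions and slow differential equations -/

section RealVariable

theorem le_left_of_eventually_le {β : Type*} [Preorder β] {g : ℝ → β} {a b : ℝ}
    (hr : ∀ t ∈ Ico a b, ∀ᶠ u in 𝓝[>] t, g u ≤ g t)
    (hl : ∀ t ∈ Ioc a b, ∃ᶠ u in 𝓝[<] t, g t ≤ g u) : ∀ t ∈ Icc a b, g t ≤ g a := by
  -- `g` may jump down, so the principle of real induction is applied to this set rather than to
  -- `{t | g t ≤ g a}`, which need not be closed.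
  set S : Set ℝ := {t | ∀ r ∈ Icc a t, g r ≤ g a}
  suffices hS : Icc a b ⊆ S from fun t ht => hS ht t ⟨ht.1, le_rfl⟩
  refine IsClosed.Icc_subset_of_forall_mem_nhdsWithin ?_ ?_ ?_
  · refine isClosed_of_closure_subset fun t ht => ?_
    have htab : t ∈ Icc a b := closure_minimal inter_subset_right isClosed_Icc ht
    have hlt : ∀ r ∈ Ico a t, g r ≤ g a := fun r hr => by
      obtain ⟨t', hrt', ht'⟩ := mem_closure_iff.1 ht (Ioi r) isOpen_Ioi hr.2
      exact ht'.1 r ⟨hr.1, hrt'.le⟩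
    refine ⟨fun r hr => ?_, htab⟩
    rcases hr.2.eq_or_lt with rfl | hrt
    · rcases hr.1.eq_or_lt with rfl | har
      · exact le_rfl
      · obtain ⟨u, hu, hua⟩ := ((hl r ⟨har, htab.2⟩).and_eventually (Ioo_mem_nhdsLT har)).exists
        exact hu.trans (hlt u ⟨hua.1.le, hua.2⟩)
    · exact hlt r ⟨hr.1, hrt⟩
  · intro r hr
    rw [le_antisymm hr.2 hr.1]
  · rintro t ⟨htS, ht⟩
    obtain ⟨u, htu, hu⟩ := mem_nhdsGT_iff_exists_Ioo_subset.1 (hr t ht)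
    filter_upwards [Ioo_mem_nhdsGT htu] with w hw r hr
    rcases le_or_gt r t with hrt | hrt
    · exact htS r ⟨hr.1, hrt⟩
    · exact (hu ⟨hrt, hr.2.trans_lt hw.2⟩).trans (htS t ⟨ht.1, le_rfl⟩)

theorem eventually_le_add_mul_nhdsGT {f : ℝ → ℝ} {f' c t : ℝ} (hf : HasDerivAt f f' t)
    (hc : f' < c) : ∀ᶠ u in 𝓝[>] t, f u ≤ f t + c * (u - t) := by
  filter_upwards [(hf.hasDerivWithinAt (s := Ioi t)).limsup_slope_le' self_notMem_Ioi hc,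
    self_mem_nhdsWithin] with u hu htu
  rw [slope_def_field, div_lt_iff₀ (sub_pos.2 htu)] at hu
  linarith

theorem eventually_le_add_mul_nhdsLT {f : ℝ → ℝ} {f' c t : ℝ} (hf : HasDerivAt f f' t)
    (hc : f' < c) : ∀ᶠ u in 𝓝[<] t, f t ≤ f u + c * (t - u) := by
  filter_upwards [(hf.hasDerivWithinAt (s := Iio t)).limsup_slope_le' self_notMem_Iio hc,
    self_mem_nhdsWithin] with u hu htu
  rw [slope_def_field, div_lt_iff_of_neg (sub_neg.2 htu)] at hu
  linarith

theorem forall_mem_Icc_of_bootstrap {E : Type*} [TopologicalSpace E] {f : ℝ → E} {U S : Set E}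
    {a b : ℝ} (hf : ContinuousOn f (Icc a b)) (hU : IsOpen U) (hS : IsClosed S) (hUS : U ⊆ S)
    (ha : f a ∈ S) (himprove : ∀ t ∈ Icc a b, (∀ r ∈ Icc a t, f r ∈ S) → f t ∈ U) :
    ∀ t ∈ Icc a b, f t ∈ U := by
  have hmem : Icc a b ⊆ f ⁻¹' S := by
    refine IsClosed.Icc_subset_of_forall_mem_nhdsGT_of_Icc_subset ?_ ha fun t ht hsub => ?_
    · rw [inter_comm]
      exact hf.preimage_isClosed_of_isClosed isClosed_Icc hS
    · have hcont : ContinuousWithinAt f (Ioi t) t :=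
        (hf t ⟨ht.1, ht.2.le⟩).mono_of_mem_nhdsWithin
          (mem_of_superset (Icc_mem_nhdsGT ht.2) (Icc_subset_Icc_left ht.1))
      have hft := himprove t ⟨ht.1, ht.2.le⟩ fun r hr => hsub hr
      exact mem_of_superset (hcont (hU.mem_nhds hft)) fun u hu => hUS hu
  exact fun t ht => himprove t ht fun r hr => hmem ⟨hr.1, hr.2.trans ht.2⟩

end RealVariable

section DifferentialEquations

open scoped NNReal

variable {E : Type*} [NormedAddCommGroup E] [NormedSpace ℝ E]

theorem hasDerivWithinAt_Ici_of_Icc {f : ℝ → E} {f' : E} {a b t : ℝ} (ht : t ∈ Ico a b)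
    (h : HasDerivWithinAt f f' (Icc a b) t) : HasDerivWithinAt f f' (Ici t) t :=
  h.mono_of_mem_nhdsWithin (mem_of_superset (Icc_mem_nhdsGE ht.2) (Icc_subset_Icc_left ht.1))

theorem exists_forall_hasDerivWithinAt_of_lipschitzWith [CompleteSpace E] {v : E → E} {K C : ℝ≥0}
    (hv : LipschitzWith K v) (hC : ∀ x, ‖v x‖ ≤ C) {τ : ℝ} (hτ : 0 ≤ τ) (x₀ : E) :
    ∃ f : ℝ → E, f 0 = x₀ ∧ ∀ t ∈ Icc 0 τ, HasDerivWithinAt f (v (f t)) (Icc 0 τ) t := by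
  have hPL : IsPicardLindelof (fun _ => v) (tmin := 0) (tmax := τ) ⟨0, le_rfl, hτ⟩ x₀
      (C * τ.toNNReal) 0 C K := by
    refine IsPicardLindelof.of_time_independent (fun x _ => hC x) hv.lipschitzOnWith ?_
    simp [hτ]
  exact hPL.exists_eq_forall_mem_Icc_hasDerivWithinAt₀

theorem exists_forall_mem_hasDerivWithinAt_of_retraction [CompleteSpace E] {v ρ : E → E}
    {S U : Set E} {Kv Kρ : ℝ≥0} (hS : IsCompact S) (hU : IsOpen U) (hUS : U ⊆ S)
    (hv : LipschitzOnWith Kv v S) (hρ : LipschitzWith Kρ ρ) (hρS : ∀ x, ρ x ∈ S)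
    (hρ_eq : ∀ x ∈ S, ρ x = x) {τ : ℝ} (hτ : 0 ≤ τ) {x₀ : E} (hx₀ : x₀ ∈ S)
    (hpriori : ∀ (f : ℝ → E), f 0 = x₀ → ∀ t ∈ Icc 0 τ,
      (∀ r ∈ Icc 0 t, f r ∈ S ∧ HasDerivWithinAt f (v (f r)) (Icc 0 t) r) → f t ∈ U) :
    ∃ f : ℝ → E, f 0 = x₀ ∧
      ∀ t ∈ Icc 0 τ, f t ∈ U ∧ HasDerivWithinAt f (v (f t)) (Icc 0 τ) t := by
  have hlip : LipschitzWith (Kv * Kρ) (v ∘ ρ) :=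
    lipschitzOnWith_univ.1 (hv.comp hρ.lipschitzOnWith fun x _ => hρS x)
  obtain ⟨C, hC⟩ := hS.exists_bound_of_continuousOn hv.continuousOn
  obtain ⟨f, hf0, hf⟩ := exists_forall_hasDerivWithinAt_of_lipschitzWith hlip
    (fun x => (hC _ (hρS x)).trans (Real.le_coe_toNNReal C)) hτ x₀
  have hfv : ∀ t ∈ Icc 0 τ, f t ∈ S → HasDerivWithinAt f (v (f t)) (Icc 0 τ) t :=
    fun t ht hft => by simpa only [Function.comp_apply, hρ_eq _ hft] using hf t ht
  have hfU : ∀ t ∈ Icc 0 τ, f t ∈ U := by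
    refine forall_mem_Icc_of_bootstrap (HasDerivWithinAt.continuousOn hf) hU hS.isClosed hUS
      (hf0 ▸ hx₀) fun t ht hft => hpriori f hf0 t ht fun r hr => ⟨hft r hr, ?_⟩
    exact (hfv r ⟨hr.1, hr.2.trans ht.2⟩ (hft r hr)).mono (Icc_subset_Icc_right ht.2)
  exact ⟨f, hf0, fun t ht => ⟨hfU t ht, hfv t ht (hUS (hfU t ht))⟩⟩

theorem exists_lipschitzWith_retraction_Icc_prod_Icc {a b c d : ℝ} (hab : a ≤ b) (hcd : c ≤ d) :
    ∃ ρ : ℝ × ℝ → ℝ × ℝ, LipschitzWith 1 ρ ∧ (∀ x, ρ x ∈ Icc a b ×ˢ Icc c d) ∧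
      ∀ x ∈ Icc a b ×ˢ Icc c d, ρ x = x := by
  refine ⟨fun x => (projIcc a b hab x.1, projIcc c d hcd x.2), ?_,
    fun x => ⟨(projIcc a b hab x.1).2, (projIcc c d hcd x.2).2⟩, fun x hx => ?_⟩
  · have hlip : ∀ {l r : ℝ} (hlr : l ≤ r), LipschitzWith 1 fun x => (projIcc l r hlr x : ℝ) :=
      fun hlr => by
        simpa [Function.comp_def] using
          (LipschitzWith.subtype_val _).comp (LipschitzWith.projIcc hlr)
    simpa using ((hlip hab).comp LipschitzWith.prod_fst).prodMk
      ((hlip hcd).comp LipschitzWith.prod_snd)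
  · simp only [projIcc_of_mem hab hx.1, projIcc_of_mem hcd hx.2]

theorem gronwallBound_slow_le {ε K T C₁ C₂ t : ℝ} (hε : 0 < ε) (hK : 1 ≤ K) (hC₁ : 0 ≤ C₁)
    (hC₂ : 0 ≤ C₂) (ht : 0 ≤ t) (htT : t ≤ T / ε) :
    gronwallBound (C₁ * ε) (ε * K) (C₂ * ε ^ 2) t ≤ (C₁ + C₂) * Real.exp (K * T) * ε := by
  have hεK : 0 < ε * K := by positivity
  have hexp : Real.exp (ε * K * t) ≤ Real.exp (K * T) := by
    rw [le_div_iff₀ hε] at htT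
    exact Real.exp_le_exp.2 (by nlinarith)
  have hone : 0 ≤ Real.exp (ε * K * t) - 1 :=
    sub_nonneg.2 (Real.one_le_exp (mul_nonneg hεK.le ht))
  have hquot : C₂ * ε ^ 2 / (ε * K) ≤ C₂ * ε := by
    rw [div_le_iff₀ hεK]
    nlinarith [mul_nonneg hC₂ (sq_nonneg ε)]
  rw [gronwallBound_of_K_ne_0 hεK.ne']
  calc C₁ * ε * Real.exp (ε * K * t) + C₂ * ε ^ 2 / (ε * K) * (Real.exp (ε * K * t) - 1)
      ≤ C₁ * ε * Real.exp (K * T) + C₂ * ε * Real.exp (K * T) := by gcongr; linarith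
    _ = (C₁ + C₂) * Real.exp (K * T) * ε := by ring

theorem dist_le_of_slow_approx_trajectory {v : E → E} {S : Set E} {K : ℝ≥0}
    (hv : LipschitzOnWith K v S) (hK : 1 ≤ K) {f f' g : ℝ → E} {ε s T C₁ C₂ : ℝ} (hε : 0 < ε)
    (hC₁ : 0 ≤ C₁) (hC₂ : 0 ≤ C₂) (hsT : s ≤ T / ε) (hf : ContinuousOn f (Icc 0 s))
    (hf' : ∀ t ∈ Ico 0 s, HasDerivWithinAt f (f' t) (Ici t) t)
    (hf'v : ∀ t ∈ Ico 0 s, dist (f' t) (ε • v (f t)) ≤ C₂ * ε ^ 2) (hfS : ∀ t ∈ Ico 0 s, f t ∈ S)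
    (hg : ∀ t ∈ Icc 0 s, HasDerivWithinAt g (ε • v (g t)) (Icc 0 s) t)
    (hgS : ∀ t ∈ Ico 0 s, g t ∈ S) (hfg : dist (f 0) (g 0) ≤ C₁ * ε) :
    ∀ t ∈ Icc 0 s, dist (f t) (g t) ≤ (C₁ + C₂) * Real.exp (K * T) * ε := by
  intro t ht
  have hεv : LipschitzOnWith (‖ε‖₊ * K) (fun x => ε • v x) S :=
    (lipschitzWith_smul ε).comp_lipschitzOnWith hv
  have hgronwall := dist_le_of_approx_trajectories_ODE_of_mem (fun _ _ => hεv) hf hf' hf'v hfS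
    (HasDerivWithinAt.continuousOn hg)
    (fun r hr => hasDerivWithinAt_Ici_of_Icc hr (hg r ⟨hr.1, hr.2.le⟩))
    (fun _ _ => (dist_self _).le) hgS hfg t ht
  rw [add_zero, sub_zero, NNReal.coe_mul, coe_nnnorm, Real.norm_of_nonneg hε.le] at hgronwall
  exact hgronwall.trans (gronwallBound_slow_le hε hK hC₁ hC₂ ht.1 (ht.2.trans hsT))

end DifferentialEquations

/-! ### The averaged system -/

section AveragedSystem

open scoped NNReal

/-- The averaged equations in the variables `(X, ε P)`, with the factor `ε` removed from the right
hand sides; `α` and `β` stand for `π ^ 2 A` and `π ^ 2 B`. -/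
def averagedField (L α β : ℝ) (p : ℝ × ℝ) : ℝ × ℝ := (p.2, α / p.1 ^ 3 - β / (L - p.1) ^ 3)

/-- Twice the averaged Hamiltonian in the variables `(X, ε P)`. -/
def averagedEnergy (L α β : ℝ) (p : ℝ × ℝ) : ℝ := p.2 ^ 2 + α / p.1 ^ 2 + β / (L - p.1) ^ 2

variable {ε L α β δ R : ℝ}

theorem abs_div_cube_sub_div_cube_le {c x y : ℝ} (hδ : 0 < δ) (hc : 0 ≤ c) (hx : δ ≤ x)
    (hy : δ ≤ y) : |c / x ^ 3 - c / y ^ 3| ≤ 3 * c / δ ^ 4 * |x - y| := by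
  have hx₀ : 0 < x := hδ.trans_le hx
  have hy₀ : 0 < y := hδ.trans_le hy
  have hfactor : c / x ^ 3 - c / y ^ 3 =
      -(c * x⁻¹ * y⁻¹ * (x⁻¹ ^ 2 + x⁻¹ * y⁻¹ + y⁻¹ ^ 2)) * (x - y) := by
    field_simp
    ring
  rw [hfactor, abs_mul, abs_neg, abs_of_nonneg (by positivity)]
  calc c * x⁻¹ * y⁻¹ * (x⁻¹ ^ 2 + x⁻¹ * y⁻¹ + y⁻¹ ^ 2) * |x - y|
      ≤ c * δ⁻¹ * δ⁻¹ * (δ⁻¹ ^ 2 + δ⁻¹ * δ⁻¹ + δ⁻¹ ^ 2) * |x - y| := by gcongr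
    _ = 3 * c / δ ^ 4 * |x - y| := by field_simp; ring

theorem lipschitzOnWith_averagedField {K : ℝ≥0} (hδ : 0 < δ) (hα : 0 ≤ α) (hβ : 0 ≤ β)
    (hK : 1 + 3 * (α + β) / δ ^ 4 ≤ K) :
    LipschitzOnWith K (averagedField L α β) (Icc δ (L - δ) ×ˢ univ) := by
  refine LipschitzOnWith.of_dist_le_mul fun p hp q hq => ?_
  have hd₁ : |p.1 - q.1| ≤ dist p q := le_max_left _ _
  have hd₂ : |p.2 - q.2| ≤ dist p q := le_max_right _ _
  have hα' := abs_div_cube_sub_div_cube_le hδ hα hp.1.1 hq.1.1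
  have hβ' := abs_div_cube_sub_div_cube_le hδ hβ (le_sub_comm.1 hp.1.2) (le_sub_comm.1 hq.1.2)
  rw [sub_sub_sub_cancel_left, abs_sub_comm q.1] at hβ'
  have hαβ : 0 ≤ 3 * (α + β) / δ ^ 4 := by positivity
  refine (max_le ?_ ?_).trans (mul_le_mul_of_nonneg_right hK dist_nonneg)
  · calc |p.2 - q.2| ≤ dist p q := hd₂
      _ ≤ (1 + 3 * (α + β) / δ ^ 4) * dist p q := by
        nlinarith [dist_nonneg (x := p) (y := q)]
  · calc |α / p.1 ^ 3 - β / (L - p.1) ^ 3 - (α / q.1 ^ 3 - β / (L - q.1) ^ 3)|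
        ≤ |α / p.1 ^ 3 - α / q.1 ^ 3| + |β / (L - p.1) ^ 3 - β / (L - q.1) ^ 3| := by
          rw [sub_sub_sub_comm]; exact abs_sub _ _
      _ ≤ 3 * (α + β) / δ ^ 4 * |p.1 - q.1| := (add_le_add hα' hβ').trans_eq (by ring)
      _ ≤ (1 + 3 * (α + β) / δ ^ 4) * dist p q := by gcongr; linarith

theorem averagedEnergy_eq_of_hasDerivWithinAt {f : ℝ → ℝ × ℝ} {s : ℝ}
    (hf : ∀ t ∈ Icc 0 s, (f t).1 ∈ Ioo 0 L ∧
      HasDerivWithinAt f (ε • averagedField L α β (f t)) (Icc 0 s) t) :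
    ∀ t ∈ Icc 0 s, averagedEnergy L α β (f t) = averagedEnergy L α β (f 0) := by
  have hderiv : ∀ t ∈ Icc 0 s,
      HasDerivWithinAt (fun t => averagedEnergy L α β (f t)) 0 (Icc 0 s) t := by
    intro t ht
    obtain ⟨hmem, hft⟩ := hf t ht
    have hx : (f t).1 ≠ 0 := hmem.1.ne'
    have hx' : L - (f t).1 ≠ 0 := (sub_pos.2 hmem.2).ne'
    have hfst : HasDerivWithinAt (fun t => (f t).1) (ε * (f t).2) (Icc 0 s) t := hft.fst
    have hsnd : HasDerivWithinAt (fun t => (f t).2)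
        (ε * (α / (f t).1 ^ 3 - β / (L - (f t).1) ^ 3)) (Icc 0 s) t := hft.snd
    have hleft := (hasDerivWithinAt_const t (Icc 0 s) α).fun_div (hfst.fun_pow 2)
      (pow_ne_zero 2 hx)
    have hright := (hasDerivWithinAt_const t (Icc 0 s) β).fun_div
      ((hfst.const_sub L).fun_pow 2) (pow_ne_zero 2 hx')
    refine (((hsnd.fun_pow 2).fun_add hleft).fun_add hright).congr_deriv ?_
    norm_num
    field_simp
    ring
  exact constant_of_has_deriv_right_zero (HasDerivWithinAt.continuousOn hderiv) fun t ht =>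
    hasDerivWithinAt_Ici_of_Icc ht (hderiv t ⟨ht.1, ht.2.le⟩)

theorem lt_of_div_sq_le_sq {c y : ℝ} (hy : 0 < y) (hc : δ ^ 2 * R ^ 2 < c)
    (h : c / y ^ 2 ≤ R ^ 2) : δ < y := by
  rw [div_le_iff₀ (by positivity), mul_comm] at h
  exact lt_of_pow_lt_pow_left₀ 2 hy.le
    (lt_of_mul_lt_mul_right (hc.trans_le h) (sq_nonneg R))

theorem mem_Ioo_and_abs_le_of_averagedEnergy_le (hR : 0 ≤ R) (hα : δ ^ 2 * R ^ 2 < α)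
    (hβ : δ ^ 2 * R ^ 2 < β) {p : ℝ × ℝ} (hp : p.1 ∈ Ioo 0 L)
    (hE : averagedEnergy L α β p ≤ R ^ 2) : p.1 ∈ Ioo δ (L - δ) ∧ |p.2| ≤ R := by
  have hα₀ : 0 ≤ α / p.1 ^ 2 :=
    div_nonneg ((by positivity : 0 ≤ δ ^ 2 * R ^ 2).trans hα.le) (sq_nonneg _)
  have hβ₀ : 0 ≤ β / (L - p.1) ^ 2 :=
    div_nonneg ((by positivity : 0 ≤ δ ^ 2 * R ^ 2).trans hβ.le) (sq_nonneg _)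
  unfold averagedEnergy at hE
  have hleft : δ < p.1 := lt_of_div_sq_le_sq hp.1 hα (by linarith [sq_nonneg p.2])
  have hright : δ < L - p.1 :=
    lt_of_div_sq_le_sq (sub_pos.2 hp.2) hβ (by linarith [sq_nonneg p.2])
  exact ⟨⟨hleft, lt_sub_comm.1 hright⟩, abs_le_of_sq_le_sq (by linarith) hR⟩

theorem mem_Ioo_and_abs_le_of_hasDerivWithinAt_averagedField {f : ℝ → ℝ × ℝ} {s : ℝ} (hR : 0 ≤ R)
    (hα : δ ^ 2 * R ^ 2 < α) (hβ : δ ^ 2 * R ^ 2 < β)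
    (hE : averagedEnergy L α β (f 0) ≤ R ^ 2)
    (hf : ∀ t ∈ Icc 0 s, (f t).1 ∈ Ioo 0 L ∧
      HasDerivWithinAt f (ε • averagedField L α β (f t)) (Icc 0 s) t) :
    ∀ t ∈ Icc 0 s, (f t).1 ∈ Ioo δ (L - δ) ∧ |(f t).2| ≤ R := fun t ht =>
  mem_Ioo_and_abs_le_of_averagedEnergy_le hR hα hβ (hf t ht).1
    ((averagedEnergy_eq_of_hasDerivWithinAt hf t ht).trans_le hE)

theorem exists_forall_hasDerivWithinAt_averagedField (ε : ℝ) {τ : ℝ} {p₀ : ℝ × ℝ} (hδ : 0 < δ)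
    (hR : 0 < R) (hτ : 0 ≤ τ) (hα : δ ^ 2 * R ^ 2 < α) (hβ : δ ^ 2 * R ^ 2 < β)
    (hp₀ : p₀.1 ∈ Ioo 0 L) (hE : averagedEnergy L α β p₀ ≤ R ^ 2) :
    ∃ f : ℝ → ℝ × ℝ, f 0 = p₀ ∧ ∀ t ∈ Icc 0 τ, (f t).1 ∈ Ioo 0 L ∧
      HasDerivWithinAt f (ε • averagedField L α β (f t)) (Icc 0 τ) t := by
  have hα₀ : 0 ≤ α := (by positivity : 0 ≤ δ ^ 2 * R ^ 2).trans hα.le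
  have hβ₀ : 0 ≤ β := (by positivity : 0 ≤ δ ^ 2 * R ^ 2).trans hβ.le
  have hpos : ∀ {x}, x ∈ Icc δ (L - δ) → x ∈ Ioo 0 L :=
    fun hx => ⟨hδ.trans_le hx.1, by linarith [hx.2]⟩
  obtain ⟨hx₀, hw₀⟩ := mem_Ioo_and_abs_le_of_averagedEnergy_le hR.le hα hβ hp₀ hE
  obtain ⟨ρ, hρ, hρS, hρ_eq⟩ := exists_lipschitzWith_retraction_Icc_prod_Icc
    (hx₀.1.trans hx₀.2).le (by linarith : -(2 * R) ≤ 2 * R)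
  obtain ⟨f, hf₀, hf⟩ := exists_forall_mem_hasDerivWithinAt_of_retraction
    (isCompact_Icc.prod isCompact_Icc) (isOpen_Ioo.prod isOpen_Ioo)
    (Set.prod_mono Ioo_subset_Icc_self Ioo_subset_Icc_self)
    ((lipschitzWith_smul ε).comp_lipschitzOnWith
      ((lipschitzOnWith_averagedField hδ hα₀ hβ₀ (Real.le_coe_toNNReal _)).mono
        (Set.prod_mono subset_rfl (subset_univ _))))
    hρ hρS hρ_eq hτ
    ⟨Ioo_subset_Icc_self hx₀, abs_le.1 (hw₀.trans (by linarith))⟩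
    fun f hf₀ t ht hf => by
      obtain ⟨hx, hw⟩ := mem_Ioo_and_abs_le_of_hasDerivWithinAt_averagedField hR.le hα hβ (hf₀ ▸ hE)
        (fun r hr => ⟨hpos (hf r hr).1.1, (hf r hr).2⟩) t ⟨ht.1, le_rfl⟩
      exact ⟨hx, abs_lt.1 (hw.trans_lt (by linarith))⟩
  exact ⟨f, hf₀, fun t ht => ⟨hpos (Ioo_subset_Icc_self (hf t ht).1.1), (hf t ht).2⟩⟩

theorem hasDerivAt_averagedHamiltonian_momentum (ε L A B P X : ℝ) :
    HasDerivAt (fun p => averagedHamiltonian ε L A B p X) (ε * (ε * P)) P := by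
  unfold averagedHamiltonian
  have h := ((((hasDerivAt_id P).fun_pow 2).const_mul (ε ^ 2)).div_const 2).add_const
    (Real.pi ^ 2 * A / (2 * X ^ 2)) |>.add_const (Real.pi ^ 2 * B / (2 * (L - X) ^ 2))
  refine h.congr_deriv ?_
  simp only [id]
  ring

theorem hasDerivAt_averagedHamiltonian_position (ε A B P : ℝ) {X : ℝ} (hX : X ∈ Ioo 0 L) :
    HasDerivAt (fun x => averagedHamiltonian ε L A B P x)
      (-(Real.pi ^ 2 * A / X ^ 3 - Real.pi ^ 2 * B / (L - X) ^ 3)) X := by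
  have hx : X ≠ 0 := hX.1.ne'
  have hx' : L - X ≠ 0 := (sub_pos.2 hX.2).ne'
  unfold averagedHamiltonian
  have hleft := (hasDerivAt_const X (Real.pi ^ 2 * A)).fun_div
    (((hasDerivAt_id X).fun_pow 2).const_mul 2) (by simpa using hx)
  have hright := (hasDerivAt_const X (Real.pi ^ 2 * B)).fun_div
    ((((hasDerivAt_id X).const_sub L).fun_pow 2).const_mul 2) (by simpa using hx')
  refine ((hleft.const_add (ε ^ 2 * P ^ 2 / 2)).fun_add hright).congr_deriv ?_
  simp only [id]
  norm_num
  field_simp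
  ring

theorem isAveragedMotion_iff {A B s : ℝ} {P X : ℝ → ℝ} (hε : ε ≠ 0) :
    IsAveragedMotion ε L A B s P X ↔ ∀ t ∈ Icc 0 s, X t ∈ Ioo 0 L ∧
      HasDerivWithinAt (fun t => (X t, ε * P t))
        (ε • averagedField L (Real.pi ^ 2 * A) (Real.pi ^ 2 * B) (X t, ε * P t)) (Icc 0 s) t := by
  have hX : ∀ t, deriv (fun p => averagedHamiltonian ε L A B p (X t)) (P t) = ε * (ε * P t) :=
    fun t => (hasDerivAt_averagedHamiltonian_momentum ε L A B (P t) (X t)).deriv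
  have hP : ∀ t, X t ∈ Ioo 0 L → -deriv (fun x => averagedHamiltonian ε L A B (P t) x) (X t) =
      Real.pi ^ 2 * A / X t ^ 3 - Real.pi ^ 2 * B / (L - X t) ^ 3 :=
    fun t ht => by rw [(hasDerivAt_averagedHamiltonian_position ε A B (P t) ht).deriv, neg_neg]
  constructor
  · rintro h t ht
    refine ⟨h.mem t ht, ((h.hasDeriv_X t ht).congr_deriv (hX t)).prodMk ?_⟩
    exact ((h.hasDeriv_P t ht).congr_deriv (hP t (h.mem t ht))).const_mul ε
  · intro h
    refine ⟨fun t ht => (h t ht).1, fun t ht => ?_, fun t ht => ?_⟩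
    · rw [hX]
      exact (h t ht).2.fst
    · rw [hP t (h t ht).1]
      have hεP : HasDerivWithinAt (fun t => ε * P t) (ε * (Real.pi ^ 2 * A / X t ^ 3 -
          Real.pi ^ 2 * B / (L - X t) ^ 3)) (Icc 0 s) t := (h t ht).2.snd
      simpa only [inv_mul_cancel_left₀ hε] using hεP.const_mul ε⁻¹

end AveragedSystem

/-! ### Reflection, impacts and the virial -/

namespace PistonState

variable {m n : ℕ} {M L R : ℝ} {z : PistonState m n}

section Reflection

/-- The mirror image of a state: the two walls, and the left and right particles, change places.
Statements on the right particles are obtained from those on the left particles of the mirror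
image. -/
def reflect (L : ℝ) (z : PistonState m n) : PistonState n m where
  X := L - z.X
  P := -z.P
  xl := fun j => L - z.xr j
  pl := fun j => -z.pr j
  xr := fun i => L - z.xl i
  pr := fun i => -z.pl i

theorem Admissible.reflect (h : z.Admissible L) : (z.reflect L).Admissible L :=
  ⟨sub_pos.2 h.2.1, sub_lt_self L h.1,
    fun j => ⟨sub_nonneg.2 (h.2.2.2 j).2, sub_le_sub_left (h.2.2.2 j).1 L⟩,
    fun i => ⟨sub_le_sub_left (h.2.2.1 i).2 L, sub_le_self L (h.2.2.1 i).1⟩⟩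

theorem hitsLeft_reflect {j : Fin n} : HitsLeft M (z.reflect L) j ↔ HitsRight M z j := by
  simp only [HitsLeft, HitsRight, reflect, sub_right_inj, neg_div, neg_lt_neg_iff]

theorem hitsRight_reflect {i : Fin m} : HitsRight M (z.reflect L) i ↔ HitsLeft M z i := by
  simp only [HitsLeft, HitsRight, reflect, sub_right_inj, neg_div, neg_lt_neg_iff]

theorem transfer_neg (M V v : ℝ) : transfer M (-V) (-v) = -transfer M V v := by
  unfold transfer
  ring

theorem reflect_free (u : ℝ) : (z.free M u).reflect L = (z.reflect L).free M u := by
  ext <;> simp only [reflect, free] <;> ring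

theorem ite_neg_zero (p : Prop) [Decidable p] (x : ℝ) :
    (if p then -x else 0) = -if p then x else 0 := by
  split_ifs <;> simp

open Classical in
theorem reflect_impact : (z.impact M L).reflect L = (z.reflect L).impact M L := by
  ext k
  · rfl
  · simp only [impact, hitsLeft_reflect, hitsRight_reflect]
    simp only [reflect, neg_div, transfer_neg, ite_neg_zero, Finset.sum_neg_distrib]
    ring
  · rfl
  · simp only [impact, hitsLeft_reflect, hitsRight_reflect]
    simp only [reflect, neg_div, transfer_neg, sub_eq_zero, eq_comm (a := L), Left.neg_neg_iff]
    split_ifs <;> ring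
  · rfl
  · simp only [impact, hitsLeft_reflect, hitsRight_reflect]
    simp only [reflect, neg_div, transfer_neg, sub_eq_self, Left.neg_pos_iff]
    split_ifs <;> ring

theorem AtMostOneContact.reflect (h : z.AtMostOneContact) : (z.reflect L).AtMostOneContact := by
  intro k hk l hl
  apply Sum.swap_leftInverse.injective
  apply h
  · rcases k with k | k <;> simpa [PistonState.reflect] using hk
  · rcases l with l | l <;> simpa [PistonState.reflect] using hl

theorem actionLeft_reflect (j : Fin n) : (z.reflect L).actionLeft j = z.actionRight L j := by
  simp only [actionLeft, actionRight, reflect, abs_neg]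

theorem actionRight_reflect (i : Fin m) : (z.reflect L).actionRight L i = z.actionLeft i := by
  simp only [actionLeft, actionRight, reflect, abs_neg, sub_sub_cancel]

end Reflection

section Impact

theorem free_free (u v : ℝ) : (z.free M u).free M v = z.free M (u + v) := by
  ext <;> simp only [free] <;> ring

theorem free_zero (M : ℝ) (z : PistonState m n) : z.free M 0 = z := by
  ext <;> simp [free]

theorem Admissible.impact (h : z.Admissible L) : (z.impact M L).Admissible L := h

open Classical in
/-- The momentum which the left particle `i` gives to the piston at an impact. -/
def hitImpulse (M : ℝ) (z : PistonState m n) (i : Fin m) : ℝ :=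
  if HitsLeft M z i then transfer M (z.P / M) (z.pl i) else 0

/-- The momentum which each particle gives to the piston at an impact. -/
def impulse (M L : ℝ) (z : PistonState m n) : Fin m ⊕ Fin n → ℝ :=
  Sum.elim (z.hitImpulse M) fun j => -(z.reflect L).hitImpulse M j

theorem hitImpulse_nonneg (hM : 0 < M) (i : Fin m) : 0 ≤ z.hitImpulse M i := by
  unfold hitImpulse
  split_ifs with hit
  · have := sub_pos.2 hit.2
    unfold transfer
    positivity
  · exact le_rfl

theorem hitImpulse_sq_sub (hM : 0 < M) (i : Fin m) :
    (z.pl i - z.hitImpulse M i) ^ 2 =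
      z.pl i ^ 2 - (2 * z.P * z.hitImpulse M i + z.hitImpulse M i ^ 2) / M := by
  have hM₁ : M + 1 ≠ 0 := by positivity
  unfold hitImpulse
  split_ifs
  · unfold transfer
    field_simp
    ring
  · simp

open Classical in
theorem impact_P : (z.impact M L).P = z.P + ∑ k, z.impulse M L k := by
  simp only [Fintype.sum_sum_type, impulse, Sum.elim_inl, Sum.elim_inr, hitImpulse,
    hitsLeft_reflect, ← add_assoc]
  simp only [impact, reflect, neg_div, transfer_neg, ite_neg_zero, neg_neg]

theorem impact_pl (i : Fin m) : (z.impact M L).pl i =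
    if z.xl i = 0 ∧ z.pl i < 0 then -z.pl i else z.pl i - z.hitImpulse M i := by
  simp only [impact, hitImpulse]
  split_ifs <;> simp

theorem hitImpulse_eq_zero_of_ne {i : Fin m} (h : z.xl i ≠ z.X) : z.hitImpulse M i = 0 :=
  if_neg fun hit => h hit.1

theorem AtMostOneContact.support_impulse (h : z.AtMostOneContact) :
    (Function.support (z.impulse M L)).Subsingleton := by
  refine h.anti fun k hk => ?_
  by_contra hcontact
  refine hk ?_
  rcases k with i | j
  · exact hitImpulse_eq_zero_of_ne hcontact
  · refine neg_eq_zero.2 (hitImpulse_eq_zero_of_ne fun heq => hcontact ?_)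
    exact sub_right_injective heq

theorem sum_eq_of_subsingleton_support {ι : Type*} [Fintype ι] {f : ι → ℝ}
    (hf : (Function.support f).Subsingleton) {k : ι} (hk : f k ≠ 0) : ∑ l, f l = f k :=
  Fintype.sum_eq_single k fun _ hlk => by_contra fun hl => hlk (hf hl hk)

theorem sq_sum_eq_of_subsingleton_support {ι : Type*} [Fintype ι] {f : ι → ℝ}
    (hf : (Function.support f).Subsingleton) : (∑ k, f k) ^ 2 = ∑ k, f k ^ 2 := by
  by_cases h : ∃ k, f k ≠ 0
  · obtain ⟨k, hk⟩ := h
    have hf₂ : (Function.support fun l => f l ^ 2).Subsingleton :=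
      hf.anti fun l hl hfl => hl (by simp [hfl])
    rw [sum_eq_of_subsingleton_support hf hk,
      sum_eq_of_subsingleton_support hf₂ (pow_ne_zero 2 hk)]
  · push Not at h
    simp [h]

end Impact

section Energy

/-- Twice the energy. -/
def energy (M : ℝ) (z : PistonState m n) : ℝ :=
  z.P ^ 2 / M + ∑ i, z.pl i ^ 2 + ∑ j, z.pr j ^ 2

theorem energy_free (u : ℝ) : (z.free M u).energy M = z.energy M := rfl

theorem energy_reflect : (z.reflect L).energy M = z.energy M := by
  simp only [energy, reflect, neg_sq]
  ring

theorem sum_sq_pl_impact (hM : 0 < M) (hX : 0 < z.X) : ∑ i, (z.impact M L).pl i ^ 2 =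
    ∑ i, z.pl i ^ 2 - (2 * z.P * ∑ i, z.hitImpulse M i + ∑ i, z.hitImpulse M i ^ 2) / M := by
  rw [Finset.mul_sum, ← Finset.sum_add_distrib, Finset.sum_div, ← Finset.sum_sub_distrib]
  refine Finset.sum_congr rfl fun i _ => ?_
  rw [impact_pl]
  split_ifs with hwall
  · simp [hitImpulse_eq_zero_of_ne (hwall.1.trans_ne hX.ne)]
  · exact hitImpulse_sq_sub hM i

theorem Admissible.energy_impact (hM : 0 < M) (h : z.Admissible L) (h₁ : z.AtMostOneContact) :
    (z.impact M L).energy M = z.energy M := by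
  have hleft := sum_sq_pl_impact (L := L) hM h.1
  have hright := sum_sq_pl_impact (L := L) hM h.reflect.1
  rw [← reflect_impact] at hright
  have hsq := sq_sum_eq_of_subsingleton_support (h₁.support_impulse (M := M) (L := L))
  have hP := impact_P (M := M) (L := L) (z := z)
  simp only [Fintype.sum_sum_type, impulse, Sum.elim_inl, Sum.elim_inr,
    Finset.sum_neg_distrib, neg_sq] at hsq hP
  simp only [PistonState.reflect, neg_sq] at hright hsq hP
  unfold energy
  rw [hleft, hright, hP]
  field_simp
  linarith

theorem abs_pl_le_of_energy_le (hM : 0 < M) (hR : 0 ≤ R) (hE : z.energy M ≤ R ^ 2) (i : Fin m) :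
    |z.pl i| ≤ R := by
  have hP : 0 ≤ z.P ^ 2 / M := by positivity
  have hr : 0 ≤ ∑ j, z.pr j ^ 2 := by positivity
  have hl := Finset.single_le_sum (fun i _ => sq_nonneg (z.pl i)) (Finset.mem_univ i)
  unfold energy at hE
  exact abs_le_of_sq_le_sq (by linarith) hR

theorem abs_velocity_le_of_energy_le {ε : ℝ} (hε : 0 ≤ ε) (hM : 0 < M) (hεM : 1 ≤ ε ^ 2 * M)
    (hR : 0 ≤ R) (hE : z.energy M ≤ R ^ 2) : |z.P / M| ≤ ε * R := by
  have hl : 0 ≤ ∑ i, z.pl i ^ 2 := by positivity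
  have hr : 0 ≤ ∑ j, z.pr j ^ 2 := by positivity
  unfold energy at hE
  have hP : z.P ^ 2 / M ≤ R ^ 2 := by linarith
  refine abs_le_of_sq_le_sq ?_ (by positivity)
  calc (z.P / M) ^ 2 = z.P ^ 2 / M * (1 / M) := by ring
    _ ≤ R ^ 2 * ε ^ 2 := by
      gcongr
      exact (div_le_iff₀ hM).2 hεM
    _ = (ε * R) ^ 2 := by ring

end Energy

section Virial

/-- The position-weighted momentum of the left particles. Adding it to the momentum of the piston
absorbs the momentum given to the piston by the left particles at impacts. -/
def leftVirial (z : PistonState m n) : ℝ := ∑ i, z.pl i * z.xl i / z.X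

/-- The sum of the virials of the two sides; an impact decreases it by the absolute value of the
momentum received by the piston. -/
def virial (L : ℝ) (z : PistonState m n) : ℝ := z.leftVirial + (z.reflect L).leftVirial

/-- The momentum of the piston, corrected to a quantity which does not jump at impacts. -/
def correctedMomentum (L : ℝ) (z : PistonState m n) : ℝ :=
  z.P + z.leftVirial - (z.reflect L).leftVirial

/-- The rate of change of `leftVirial` in free flight. -/
def leftForce (M : ℝ) (z : PistonState m n) : ℝ :=
  ∑ i, (z.pl i ^ 2 / z.X - z.pl i * z.xl i * (z.P / M) / z.X ^ 2)

theorem leftVirial_impact (hX : 0 < z.X) :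
    (z.impact M L).leftVirial = z.leftVirial - ∑ i, z.hitImpulse M i := by
  unfold leftVirial
  rw [← Finset.sum_sub_distrib]
  refine Finset.sum_congr rfl fun i _ => ?_
  rw [impact_pl]
  simp only [impact]
  split_ifs with hwall
  · simp [hwall.1, hitImpulse_eq_zero_of_ne (hwall.1.trans_ne hX.ne)]
  · by_cases hcontact : z.xl i = z.X
    · rw [hcontact]
      field_simp
    · simp [hitImpulse_eq_zero_of_ne hcontact]

theorem Admissible.leftVirial_reflect_impact (h : z.Admissible L) :
    ((z.impact M L).reflect L).leftVirial =
      (z.reflect L).leftVirial - ∑ j, (z.reflect L).hitImpulse M j := by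
  rw [reflect_impact, leftVirial_impact h.reflect.1]

theorem impact_P_eq_add_sub : (z.impact M L).P =
    z.P + (∑ i, z.hitImpulse M i - ∑ j, (z.reflect L).hitImpulse M j) := by
  simp only [impact_P, Fintype.sum_sum_type, impulse, Sum.elim_inl, Sum.elim_inr,
    Finset.sum_neg_distrib, sub_eq_add_neg]

theorem Admissible.correctedMomentum_impact (h : z.Admissible L) :
    (z.impact M L).correctedMomentum L = z.correctedMomentum L := by
  unfold correctedMomentum
  rw [impact_P_eq_add_sub, leftVirial_impact h.1, h.leftVirial_reflect_impact]
  ring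

theorem Admissible.abs_impact_P_sub_le (hM : 0 < M) (h : z.Admissible L) :
    |(z.impact M L).P - z.P| ≤ z.virial L - (z.impact M L).virial L := by
  have hl : 0 ≤ ∑ i, z.hitImpulse M i := Finset.sum_nonneg fun i _ => hitImpulse_nonneg hM i
  have hr : 0 ≤ ∑ j, (z.reflect L).hitImpulse M j :=
    Finset.sum_nonneg fun j _ => hitImpulse_nonneg hM j
  unfold virial
  rw [impact_P_eq_add_sub, leftVirial_impact h.1, h.leftVirial_reflect_impact, abs_le]
  constructor <;> linarith

theorem hasDerivAt_free_X : HasDerivAt (fun u => (z.free M u).X) (z.P / M) 0 := by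
  simpa [free] using ((hasDerivAt_id (0 : ℝ)).mul_const (z.P / M)).const_add z.X

theorem hasDerivAt_leftVirial (hX : z.X ≠ 0) :
    HasDerivAt (fun u => (z.free M u).leftVirial) (z.leftForce M) 0 := by
  unfold leftVirial leftForce
  refine HasDerivAt.fun_sum fun i _ => ?_
  have hx : HasDerivAt (fun u => (z.free M u).xl i) (z.pl i) 0 := by
    simpa [free] using ((hasDerivAt_id (0 : ℝ)).mul_const (z.pl i)).const_add (z.xl i)
  refine ((hx.const_mul (z.pl i)).fun_div hasDerivAt_free_X
    (by rwa [free_zero])).congr_deriv ?_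
  rw [free_zero]
  field_simp

theorem Admissible.hasDerivAt_leftVirial_reflect (h : z.Admissible L) :
    HasDerivAt (fun u => ((z.free M u).reflect L).leftVirial) ((z.reflect L).leftForce M) 0 := by
  simp only [reflect_free]
  exact hasDerivAt_leftVirial h.reflect.1.ne'

theorem Admissible.hasDerivAt_virial (h : z.Admissible L) :
    HasDerivAt (fun u => (z.free M u).virial L) (z.leftForce M + (z.reflect L).leftForce M) 0 :=
  (hasDerivAt_leftVirial h.1.ne').fun_add h.hasDerivAt_leftVirial_reflect

theorem Admissible.hasDerivAt_correctedMomentum (h : z.Admissible L) :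
    HasDerivAt (fun u => (z.free M u).correctedMomentum L)
      (z.leftForce M - (z.reflect L).leftForce M) 0 :=
  ((hasDerivAt_leftVirial h.1.ne').const_add z.P).fun_sub h.hasDerivAt_leftVirial_reflect

end Virial

end PistonState

/-! ### Estimates for a confined piston -/

namespace PistonState

variable {m n : ℕ} {ε M L R δ α β : ℝ} {z : PistonState m n}

section Invariant

/-- The adiabatic invariant of the left particles, `π ^ 2 ∑ I_{l,i} ^ 2` with a correction of first
order in the velocity of the piston which makes it exactly constant in free flight. -/
def leftInvariant (M : ℝ) (z : PistonState m n) : ℝ :=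
  ∑ i, (z.pl i * z.X - z.xl i * (z.P / M)) ^ 2

theorem leftInvariant_free (u : ℝ) : (z.free M u).leftInvariant M = z.leftInvariant M := by
  unfold leftInvariant
  refine Finset.sum_congr rfl fun i _ => ?_
  simp only [free]
  ring

theorem pi_sq_mul_sum_actionLeft_sq :
    Real.pi ^ 2 * ∑ i, z.actionLeft i ^ 2 = z.X ^ 2 * ∑ i, z.pl i ^ 2 := by
  simp only [Finset.mul_sum, actionLeft, div_pow, mul_pow, sq_abs]
  refine Finset.sum_congr rfl fun i _ => ?_
  field_simp [Real.pi_ne_zero]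

theorem abs_sq_mul_sub_mul_sub_le {p x X V W : ℝ} (hp : |p| ≤ R) (hX : |X| ≤ L) (hx : |x| ≤ L)
    (hV : |V| ≤ R) (hW : |W| ≤ R) :
    |(p * X - x * W) ^ 2 - (p * X - x * V) ^ 2| ≤ 4 * R * L ^ 2 * |W - V| := by
  have hR : 0 ≤ R := (abs_nonneg p).trans hp
  have hL : 0 ≤ L := (abs_nonneg X).trans hX
  calc |(p * X - x * W) ^ 2 - (p * X - x * V) ^ 2|
      = |x| * |W - V| * |2 * (p * X) - (x * W + x * V)| := by
        rw [← abs_mul, ← abs_mul, ← abs_neg]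
        ring_nf
    _ ≤ |x| * |W - V| * (2 * (|p| * |X|) + (|x| * |W| + |x| * |V|)) := by
        gcongr
        refine (abs_sub _ _).trans (add_le_add ?_ ((abs_add_le _ _).trans_eq ?_))
        · rw [abs_mul, abs_mul, abs_two]
        · rw [abs_mul, abs_mul]
    _ ≤ L * |W - V| * (2 * (R * L) + (L * R + L * R)) := by gcongr
    _ = 4 * R * L ^ 2 * |W - V| := by ring

theorem xl_eq_X_of_hitImpulse_ne_zero {i : Fin m} (h : z.hitImpulse M i ≠ 0) : z.xl i = z.X :=
  not_imp_comm.1 hitImpulse_eq_zero_of_ne h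

theorem relative_velocity_of_hitImpulse_ne_zero (hM : 0 < M) {i : Fin m}
    (h : z.hitImpulse M i ≠ 0) :
    z.pl i - z.hitImpulse M i - (z.P + z.hitImpulse M i) / M = -(z.pl i - z.P / M) := by
  have hM₁ : M + 1 ≠ 0 := by positivity
  have hhit : HitsLeft M z i := by_contra fun hhit => h (if_neg hhit)
  rw [hitImpulse, if_pos hhit, transfer]
  field_simp
  ring

theorem abs_sum_le_mul {f : Fin m → ℝ} {c : ℝ} (hf : ∀ i, |f i| ≤ c) : |∑ i, f i| ≤ m * c := by
  simpa using (Finset.abs_sum_le_sum_abs f Finset.univ).trans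
    (Finset.sum_le_card_nsmul Finset.univ _ c fun i _ => hf i)

end Invariant

section Confined

/-- The piston is at distance at least `δ` from both walls, and twice the energy is at most
`R ^ 2`. -/
structure IsConfined (M L R δ : ℝ) (z : PistonState m n) : Prop where
  admissible : z.Admissible L
  energy_le : z.energy M ≤ R ^ 2
  le_X : δ ≤ z.X
  X_le : z.X ≤ L - δ

namespace IsConfined

theorem reflect (h : z.IsConfined M L R δ) : (z.reflect L).IsConfined M L R δ where
  admissible := h.admissible.reflect
  energy_le := energy_reflect.trans_le h.energy_le
  le_X := le_sub_comm.1 h.X_le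
  X_le := sub_le_sub_left h.le_X L

theorem impact (hM : 0 < M) (h : z.IsConfined M L R δ) (h₁ : z.AtMostOneContact) :
    (z.impact M L).IsConfined M L R δ where
  admissible := h.admissible.impact
  energy_le := (h.admissible.energy_impact hM h₁).trans_le h.energy_le
  le_X := h.le_X
  X_le := h.X_le

theorem abs_pl_le (hM : 0 < M) (hR : 0 ≤ R) (h : z.IsConfined M L R δ) (i : Fin m) :
    |z.pl i| ≤ R :=
  abs_pl_le_of_energy_le hM hR h.energy_le i

theorem abs_velocity_le (hM : 1 ≤ M) (hR : 0 ≤ R) (h : z.IsConfined M L R δ) : |z.P / M| ≤ R := by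
  simpa using abs_velocity_le_of_energy_le zero_le_one (zero_lt_one.trans_le hM) (by simpa using hM)
    hR h.energy_le

theorem abs_X_le (h : z.IsConfined M L R δ) : |z.X| ≤ L := by
  rw [abs_of_pos h.admissible.1]
  exact h.admissible.2.1.le

theorem abs_xl_le_X (h : z.IsConfined M L R δ) (i : Fin m) : |z.xl i| ≤ z.X := by
  rw [abs_of_nonneg (h.admissible.2.2.1 i).1]
  exact (h.admissible.2.2.1 i).2

theorem abs_xl_le (h : z.IsConfined M L R δ) (i : Fin m) : |z.xl i| ≤ L :=
  (h.abs_xl_le_X i).trans h.admissible.2.1.le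

theorem abs_leftInvariant_sub_le (hM : 1 ≤ M) (hR : 0 ≤ R) (h : z.IsConfined M L R δ) :
    |z.leftInvariant M - Real.pi ^ 2 * ∑ i, z.actionLeft i ^ 2| ≤
      m * (4 * R * L ^ 2 * |z.P / M|) := by
  rw [pi_sq_mul_sum_actionLeft_sq, Finset.mul_sum, leftInvariant, ← Finset.sum_sub_distrib]
  refine abs_sum_le_mul fun i => ?_
  simpa [mul_pow, mul_comm] using abs_sq_mul_sub_mul_sub_le (V := 0)
    (h.abs_pl_le (zero_lt_one.trans_le hM) hR i) h.abs_X_le (h.abs_xl_le i) (by simpa using hR)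
    (h.abs_velocity_le hM hR)

theorem leftInvariant_le (hM : 1 ≤ M) (hR : 0 ≤ R) (h : z.IsConfined M L R δ) :
    z.leftInvariant M ≤ m * (2 * R * z.X) ^ 2 := by
  refine (le_abs_self _).trans (abs_sum_le_mul fun i => ?_)
  rw [abs_sq]
  refine sq_le_sq.2 ?_
  have hX := h.admissible.1.le
  calc |z.pl i * z.X - z.xl i * (z.P / M)| ≤ |z.pl i| * |z.X| + |z.xl i| * |z.P / M| := by
        rw [← abs_mul, ← abs_mul]
        exact abs_sub _ _
    _ ≤ R * z.X + z.X * R := by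
        rw [abs_of_nonneg hX]
        gcongr
        exacts [h.abs_pl_le (zero_lt_one.trans_le hM) hR i, h.abs_xl_le_X i,
          h.abs_velocity_le hM hR]
    _ ≤ |2 * R * z.X| := by
        rw [abs_of_nonneg (by positivity)]
        linarith

theorem abs_sq_impact_sub_le (hM : 1 ≤ M) (hR : 0 ≤ R) (h : z.IsConfined M L R δ)
    (h₁ : z.AtMostOneContact) (i : Fin m) :
    |((z.impact M L).pl i * z.X - z.xl i * ((z.impact M L).P / M)) ^ 2 -
        (z.pl i * z.X - z.xl i * (z.P / M)) ^ 2| ≤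
      4 * R * L ^ 2 * |(z.impact M L).P / M - z.P / M| := by
  have hM₀ : 0 < M := zero_lt_one.trans_le hM
  have hL : 0 ≤ 4 * R * L ^ 2 * |(z.impact M L).P / M - z.P / M| := by positivity
  rw [impact_pl]
  split_ifs with hwall
  · simpa [hwall.1] using hL
  · by_cases hhit : z.hitImpulse M i = 0
    · rw [hhit, sub_zero]
      exact abs_sq_mul_sub_mul_sub_le (h.abs_pl_le hM₀ hR i) h.abs_X_le (h.abs_xl_le i)
        (h.abs_velocity_le hM hR) ((h.impact hM₀ h₁).abs_velocity_le hM hR)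
    · have hP : (z.impact M L).P = z.P + z.hitImpulse M i := by
        rw [impact_P, sum_eq_of_subsingleton_support h₁.support_impulse (k := Sum.inl i) hhit]
        rfl
      rw [hP, xl_eq_X_of_hitImpulse_ne_zero hhit, mul_comm z.X, ← sub_mul,
        relative_velocity_of_hitImpulse_ne_zero hM₀ hhit, mul_comm z.X, ← sub_mul, neg_mul, neg_sq,
        sub_self, abs_zero]
      positivity

theorem abs_leftInvariant_impact_sub_le (hM : 1 ≤ M) (hR : 0 ≤ R) (h : z.IsConfined M L R δ)
    (h₁ : z.AtMostOneContact) :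
    |(z.impact M L).leftInvariant M - z.leftInvariant M| ≤
      m * (4 * R * L ^ 2) / M * |(z.impact M L).P - z.P| := by
  have hM₀ : 0 < M := zero_lt_one.trans_le hM
  rw [leftInvariant, leftInvariant, ← Finset.sum_sub_distrib]
  refine (abs_sum_le_mul (h.abs_sq_impact_sub_le hM hR h₁)).trans_eq ?_
  rw [← sub_div, abs_div, abs_of_pos hM₀]
  ring

end IsConfined

end Confined

section Force

namespace IsConfined

theorem abs_leftVirial_le (hM : 0 < M) (hR : 0 ≤ R) (h : z.IsConfined M L R δ) :
    |z.leftVirial| ≤ m * R := by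
  refine abs_sum_le_mul fun i => ?_
  have hX : |z.xl i / z.X| ≤ 1 := by
    rw [abs_div, abs_of_pos h.admissible.1]
    exact div_le_one_of_le₀ (h.abs_xl_le_X i) h.admissible.1.le
  rw [mul_div_assoc, abs_mul, ← mul_one R]
  exact mul_le_mul (h.abs_pl_le hM hR i) hX (abs_nonneg _) hR

theorem abs_virial_le (hM : 0 < M) (hR : 0 ≤ R) (h : z.IsConfined M L R δ) :
    |z.virial L| ≤ (m + n) * R := by
  refine (abs_add_le _ _).trans ?_
  rw [add_mul]
  exact add_le_add (h.abs_leftVirial_le hM hR) (h.reflect.abs_leftVirial_le hM hR)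

theorem abs_correctedMomentum_sub_le (hM : 0 < M) (hR : 0 ≤ R) (h : z.IsConfined M L R δ) :
    |z.correctedMomentum L - z.P| ≤ (m + n) * R := by
  rw [correctedMomentum, add_sub_assoc, add_sub_cancel_left, add_mul]
  exact (abs_sub _ _).trans
    (add_le_add (h.abs_leftVirial_le hM hR) (h.reflect.abs_leftVirial_le hM hR))

theorem abs_leftForce_le (hM : 1 ≤ M) (hR : 0 ≤ R) (hδ : 0 < δ) (h : z.IsConfined M L R δ) :
    |z.leftForce M| ≤ m * (2 * R ^ 2 / δ) := by
  refine abs_sum_le_mul fun i => ?_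
  have hX := h.admissible.1
  have hp := h.abs_pl_le (zero_lt_one.trans_le hM) hR i
  calc |z.pl i ^ 2 / z.X - z.pl i * z.xl i * (z.P / M) / z.X ^ 2|
      ≤ |z.pl i| ^ 2 / z.X + |z.pl i| * |z.xl i| * |z.P / M| / z.X ^ 2 := by
        refine (abs_sub _ _).trans_eq ?_
        rw [abs_div, abs_div, abs_mul, abs_mul, abs_pow, abs_pow, abs_of_pos hX]
    _ ≤ R ^ 2 / z.X + R * z.X * R / z.X ^ 2 := by
        gcongr
        exacts [h.abs_xl_le_X i, h.abs_velocity_le hM hR]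
    _ = 2 * R ^ 2 / z.X := by
        field_simp
        ring
    _ ≤ 2 * R ^ 2 / δ := by
        gcongr
        exact h.le_X

theorem abs_leftForce_mul_cube_sub_le (hM : 1 ≤ M) (hR : 0 ≤ R) (h : z.IsConfined M L R δ) :
    |z.leftForce M * z.X ^ 3 - z.leftInvariant M| ≤ m * (2 * L ^ 2 * R * |z.P / M|) := by
  have hX := h.admissible.1
  have hL : 0 ≤ L := (abs_nonneg _).trans h.abs_X_le
  rw [leftForce, leftInvariant, Finset.sum_mul, ← Finset.sum_sub_distrib]
  refine abs_sum_le_mul fun i => ?_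
  calc |(z.pl i ^ 2 / z.X - z.pl i * z.xl i * (z.P / M) / z.X ^ 2) * z.X ^ 3 -
          (z.pl i * z.X - z.xl i * (z.P / M)) ^ 2|
      = |z.xl i| * |z.P / M| * |z.pl i * z.X - z.xl i * (z.P / M)| := by
        rw [← abs_mul, ← abs_mul]
        congr 1
        field_simp
        ring
    _ ≤ |z.xl i| * |z.P / M| * (|z.pl i| * |z.X| + |z.xl i| * |z.P / M|) := by
        gcongr
        rw [← abs_mul, ← abs_mul]
        exact abs_sub _ _
    _ ≤ L * |z.P / M| * (R * L + L * R) := by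
        gcongr
        exacts [h.abs_xl_le i, h.abs_pl_le (zero_lt_one.trans_le hM) hR i, h.abs_X_le,
          h.abs_xl_le i, h.abs_velocity_le hM hR]
    _ = 2 * L ^ 2 * R * |z.P / M| := by ring

theorem abs_leftForce_sub_le (hM : 1 ≤ M) (hR : 0 ≤ R) (hδ : 0 < δ) (h : z.IsConfined M L R δ)
    {D : ℝ} (hα : |z.leftInvariant M - α| ≤ D) :
    |z.leftForce M - α / z.X ^ 3| ≤ (m * (2 * L ^ 2 * R * |z.P / M|) + D) / δ ^ 3 := by
  have hX := h.admissible.1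
  have hfactor : z.leftForce M - α / z.X ^ 3 = (z.leftForce M * z.X ^ 3 - α) / z.X ^ 3 := by
    field_simp
  rw [hfactor, abs_div, abs_of_pos (pow_pos hX 3)]
  gcongr
  · exact (abs_nonneg _).trans ((abs_sub_le _ _ _).trans
      (add_le_add (h.abs_leftForce_mul_cube_sub_le hM hR) hα))
  · exact (abs_sub_le _ _ _).trans (add_le_add (h.abs_leftForce_mul_cube_sub_le hM hR) hα)
  · exact h.le_X

end IsConfined

end Force

section Slow

/-- The variables `(X, ε P)` of the averaged equations, with the momentum corrected so as to evolve
continuously. -/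
def slowState (ε L : ℝ) (z : PistonState m n) : ℝ × ℝ := (z.X, ε * z.correctedMomentum L)

/-- The rate of change of `slowState` in free flight. -/
def slowVelocity (ε M L : ℝ) (z : PistonState m n) : ℝ × ℝ :=
  (z.P / M, ε * (z.leftForce M - (z.reflect L).leftForce M))

theorem Admissible.slowState_impact (h : z.Admissible L) :
    (z.impact M L).slowState ε L = z.slowState ε L :=
  Prod.ext rfl (congrArg (ε * ·) h.correctedMomentum_impact)

theorem Admissible.hasDerivAt_slowState (h : z.Admissible L) :
    HasDerivAt (fun u => (z.free M u).slowState ε L) (z.slowVelocity ε M L) 0 :=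
  hasDerivAt_free_X.prodMk (h.hasDerivAt_correctedMomentum.const_mul ε)

theorem IsConfined.dist_slowState_le (hε : 0 ≤ ε) (hM : 0 < M) (hR : 0 ≤ R)
    (h : z.IsConfined M L R δ) :
    dist (z.slowState ε L) (z.X, ε * z.P) ≤ (m + n) * R * ε := by
  rw [Prod.dist_eq, Real.dist_eq, Real.dist_eq, slowState]
  refine max_le ?_ ?_
  · simp only [sub_self, abs_zero]
    positivity
  · rw [← mul_sub, abs_mul, abs_of_nonneg hε, mul_comm]
    gcongr
    exact h.abs_correctedMomentum_sub_le hM hR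

theorem IsConfined.dist_slowVelocity_le (hε : 0 ≤ ε) (hM : 1 ≤ M) (hεM : ε ^ 2 * M = 1)
    (hR : 0 ≤ R) (hδ : 0 < δ) (h : z.IsConfined M L R δ) {D : ℝ}
    (hα : |z.leftInvariant M - α| ≤ D * ε) (hβ : |(z.reflect L).leftInvariant M - β| ≤ D * ε) :
    dist (z.slowVelocity ε M L) (ε • averagedField L α β (z.slowState ε L)) ≤
      ((m + n) * R + (2 * (m + n) * L ^ 2 * R ^ 2 + 2 * D) / δ ^ 3) * ε ^ 2 := by
  have hM₀ : 0 < M := zero_lt_one.trans_le hM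
  have hV : z.P / M = ε * (ε * z.P) := by
    rw [div_eq_iff hM₀.ne', ← mul_assoc ε, ← sq, mul_right_comm, hεM, one_mul]
  have hVR : |z.P / M| ≤ ε * R := abs_velocity_le_of_energy_le hε hM₀ hεM.ge hR h.energy_le
  have hVR' : |(z.reflect L).P / M| ≤ ε * R :=
    abs_velocity_le_of_energy_le hε hM₀ hεM.ge hR h.reflect.energy_le
  rw [Prod.dist_eq, Real.dist_eq, Real.dist_eq, add_mul]
  simp only [slowVelocity, slowState, averagedField, Prod.smul_mk, smul_eq_mul]
  refine max_le (le_add_of_le_of_nonneg ?_ ?_) (le_add_of_nonneg_of_le ?_ ?_)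
  · rw [hV, ← mul_sub, ← mul_sub, ← mul_assoc, abs_mul, abs_mul_self, ← sq, abs_sub_comm, mul_comm]
    gcongr
    exact h.abs_correctedMomentum_sub_le hM₀ hR
  · have hD : 0 ≤ 2 * D * ε := by linarith [(abs_nonneg _).trans hα]
    calc 0 ≤ (2 * (m + n) * L ^ 2 * R ^ 2 * ε + 2 * D * ε) / δ ^ 3 * ε := by positivity
      _ = (2 * (m + n) * L ^ 2 * R ^ 2 + 2 * D) / δ ^ 3 * ε ^ 2 := by ring
  · positivity
  · rw [← mul_sub, sub_sub_sub_comm, abs_mul, abs_of_nonneg hε]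
    calc ε * |z.leftForce M - α / z.X ^ 3 - ((z.reflect L).leftForce M - β / (L - z.X) ^ 3)|
        ≤ ε * ((m * (2 * L ^ 2 * R * |z.P / M|) + D * ε) / δ ^ 3 +
            (n * (2 * L ^ 2 * R * |(z.reflect L).P / M|) + D * ε) / δ ^ 3) := by
          gcongr
          exact (abs_sub _ _).trans (add_le_add (h.abs_leftForce_sub_le hM hR hδ hα)
            (h.reflect.abs_leftForce_sub_le hM hR hδ hβ))
      _ ≤ ε * ((m * (2 * L ^ 2 * R * (ε * R)) + D * ε) / δ ^ 3 +
            (n * (2 * L ^ 2 * R * (ε * R)) + D * ε) / δ ^ 3) := by gcongr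
      _ = (2 * (m + n) * L ^ 2 * R ^ 2 + 2 * D) / δ ^ 3 * ε ^ 2 := by ring

end Slow

end PistonState

/-! ### Drift of the adiabatic invariants -/

namespace PistonState

variable {m n : ℕ} {ε M L R T δ s t : ℝ} {z : ℝ → PistonState m n}

theorem hasDerivAt_free_sub {E : Type*} [NormedAddCommGroup E] [NormedSpace ℝ E]
    {F : PistonState m n → E} {F' : E} {w : PistonState m n}
    (h : HasDerivAt (fun u => F (w.free M u)) F' 0) (t : ℝ) :
    HasDerivAt (fun u => F (w.free M (u - t))) F' t := by
  rw [← sub_self t] at h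
  exact h.comp_sub_const t t

theorem one_le_of_sq_mul_eq_one (hε : 0 < ε) (hε₁ : ε ≤ 1)
    (hεM : ε ^ 2 * M = 1) : 1 ≤ M := by
  have hM₀ : 0 < M := pos_of_mul_pos_right (hεM ▸ one_pos) (sq_nonneg ε)
  rw [← hεM]
  exact mul_le_of_le_one_left hM₀.le (pow_le_one₀ hε.le hε₁)

/-- `driftBound N L R δ T * ε` bounds, up to the time `T / ε`, the deviation of the adiabatic
invariant of each side from the initial value of `π ^ 2 ∑ I ^ 2`; `N` is the number of
particles. -/
def driftBound (N L R δ T : ℝ) : ℝ :=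
  4 * N * R ^ 2 * L ^ 2 + 8 * N ^ 2 * R ^ 2 * L ^ 2 * (1 + R * T / δ)

namespace IsMotion

section Functionals

theorem mono {s' : ℝ} (hz : IsMotion M L s z) (hs' : s' ≤ s) : IsMotion M L s' z where
  admissible t ht := hz.admissible t (Icc_subset_Icc_right hs' ht)
  no_simultaneous t ht := hz.no_simultaneous t (Ico_subset_Ico_right hs' ht)
  after t ht := hz.after t (Ico_subset_Ico_right hs' ht)
  before t ht := hz.before t (Ioc_subset_Ioc_right hs' ht)

theorem reflect (hz : IsMotion M L s z) : IsMotion M L s fun t => (z t).reflect L where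
  admissible t ht := (hz.admissible t ht).reflect
  no_simultaneous t ht := (hz.no_simultaneous t ht).reflect
  after t ht := (hz.after t ht).mono fun u hu => by rw [hu, reflect_free, reflect_impact]
  before t ht := (hz.before t ht).mono fun u hu => by
    conv_lhs => rw [hu]
    exact reflect_free _

theorem eventually_eq_free_left (hz : IsMotion M L s z) (ht : t ∈ Ioc 0 s) :
    ∀ᶠ u in 𝓝[<] t, z u = (z t).free M (u - t) := by
  filter_upwards [hz.before t ht] with u hu
  rw [hu, free_free, sub_add_sub_cancel, sub_self, free_zero]

theorem exists_eq_free_impact (hz : IsMotion M L s z) (ht : t ∈ Ico 0 s) :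
    ∃ u ∈ Ioo t s, z u = ((z t).impact M L).free M (u - t) :=
  ((eventually_of_mem (Ioo_mem_nhdsGT ht.2) fun _ hu => hu).and (hz.after t ht)).exists

variable {E : Type*} [NormedAddCommGroup E] [NormedSpace ℝ E]

theorem hasDerivWithinAt_Ici {F : PistonState m n → E} {F' : E} (hz : IsMotion M L s z)
    (ht : t ∈ Ico 0 s) (himpact : F ((z t).impact M L) = F (z t))
    (hF : HasDerivAt (fun u => F (((z t).impact M L).free M u)) F' 0) :
    HasDerivWithinAt (fun t => F (z t)) F' (Ici t) t := by
  rw [← hasDerivWithinAt_Ioi_iff_Ici]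
  refine (hasDerivAt_free_sub hF t).hasDerivWithinAt.congr_of_eventuallyEq ?_ ?_
  · exact (hz.after t ht).mono fun u hu => congrArg F hu
  · rw [sub_self, free_zero, himpact]

theorem hasDerivWithinAt_Iic {F : PistonState m n → E} {F' : E} (hz : IsMotion M L s z)
    (ht : t ∈ Ioc 0 s) (hF : HasDerivAt (fun u => F ((z t).free M u)) F' 0) :
    HasDerivWithinAt (fun t => F (z t)) F' (Iic t) t := by
  rw [← hasDerivWithinAt_Iio_iff_Iic]
  refine (hasDerivAt_free_sub hF t).hasDerivWithinAt.congr_of_eventuallyEq ?_ ?_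
  · exact (hz.eventually_eq_free_left ht).mono fun u hu => congrArg F hu
  · rw [sub_self, free_zero]

theorem continuousOn {F F' : PistonState m n → E} (hz : IsMotion M L s z)
    (himpact : ∀ w : PistonState m n, w.Admissible L → F (w.impact M L) = F w)
    (hF : ∀ w : PistonState m n, w.Admissible L →
      HasDerivAt (fun u => F (w.free M u)) (F' w) 0) :
    ContinuousOn (fun t => F (z t)) (Icc 0 s) := by
  intro t ht
  have hw := hz.admissible t ht
  rw [← Icc_union_Icc_eq_Icc ht.1 ht.2, continuousWithinAt_union]
  constructor
  · rcases ht.1.eq_or_lt with rfl | h₀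
    · simp
    · exact (hz.hasDerivWithinAt_Iic ⟨h₀, ht.2⟩ (hF _ hw)).continuousWithinAt.mono
        Icc_subset_Iic_self
  · rcases ht.2.eq_or_lt with rfl | hs
    · simp
    · exact (hz.hasDerivWithinAt_Ici ⟨ht.1, hs⟩ (himpact _ hw)
        (hF _ hw.impact)).continuousWithinAt.mono Icc_subset_Ici_self

theorem le_add_mul {F F' : PistonState m n → ℝ} {D : Set (PistonState m n)} {c : ℝ}
    (hz : IsMotion M L s z) (hD : ∀ t ∈ Icc 0 s, z t ∈ D)
    (hDimpact : ∀ t ∈ Ico 0 s, (z t).impact M L ∈ D)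
    (himpact : ∀ t ∈ Ico 0 s, F ((z t).impact M L) ≤ F (z t))
    (hF : ∀ w ∈ D, HasDerivAt (fun u => F (w.free M u)) (F' w) 0) (hc : ∀ w ∈ D, F' w ≤ c) :
    ∀ t ∈ Icc 0 s, F (z t) ≤ F (z 0) + c * t := by
  intro t ht
  suffices hstrict : ∀ c' > c, F (z t) ≤ F (z 0) + c' * t by
    have hlim : Tendsto (fun c' => F (z 0) + c' * t) (𝓝[>] c) (𝓝 (F (z 0) + c * t)) :=
      ((continuous_mul_const t).const_add (F (z 0))).continuousWithinAt
    exact ge_of_tendsto hlim (eventually_mem_nhdsWithin.mono hstrict)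
  intro c' hc'
  have hdecreasing : F (z t) - c' * t ≤ F (z 0) - c' * 0 := by
    refine le_left_of_eventually_le (g := fun r => F (z r) - c' * r) ?_ ?_ t ht
    · intro r hr
      filter_upwards [hz.after r hr, eventually_le_add_mul_nhdsGT
        (hasDerivAt_free_sub (hF _ (hDimpact r hr)) r) ((hc _ (hDimpact r hr)).trans_lt hc')]
        with u hu hle
      rw [sub_self, free_zero, ← hu] at hle
      linarith [himpact r hr]
    · intro r hr
      have hrD := hD r (Ioc_subset_Icc_self hr)
      refine Eventually.frequently ?_
      filter_upwards [hz.eventually_eq_free_left hr, eventually_le_add_mul_nhdsLT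
        (hasDerivAt_free_sub (hF _ hrD) r) ((hc _ hrD).trans_lt hc')] with u hu hle
      rw [sub_self, free_zero, ← hu] at hle
      linarith
  linarith

theorem abs_sub_le_of_impact {F G G' : PistonState m n → ℝ} {D : Set (PistonState m n)} {c : ℝ}
    (hz : IsMotion M L s z) (hD : ∀ t ∈ Icc 0 s, z t ∈ D)
    (hDimpact : ∀ t ∈ Ico 0 s, (z t).impact M L ∈ D)
    (himpact : ∀ t ∈ Ico 0 s, |F ((z t).impact M L) - F (z t)| ≤ G (z t) - G ((z t).impact M L))
    (hF : ∀ (w : PistonState m n) (u : ℝ), F (w.free M u) = F w)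
    (hG : ∀ w ∈ D, HasDerivAt (fun u => G (w.free M u)) (G' w) 0) (hc : ∀ w ∈ D, G' w ≤ c) :
    ∀ t ∈ Icc 0 s, |F (z t) - F (z 0)| ≤ G (z 0) - G (z t) + c * t := by
  intro t ht
  have hplus := hz.le_add_mul (F := fun w => F w + G w) hD hDimpact
    (fun r hr => by linarith [(abs_le.1 (himpact r hr)).2])
    (fun w hw => by simpa only [hF] using (hG w hw).const_add (F w)) hc t ht
  have hminus := hz.le_add_mul (F := fun w => -F w + G w) hD hDimpact
    (fun r hr => by linarith [(abs_le.1 (himpact r hr)).1])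
    (fun w hw => by simpa only [hF] using (hG w hw).const_add (-F w)) hc t ht
  exact abs_le.2 ⟨by linarith, by linarith⟩

theorem energy_eq (hM : 0 < M) (hz : IsMotion M L s z) :
    ∀ t ∈ Icc 0 s, (z t).energy M = (z 0).energy M := by
  intro t ht
  have h := hz.abs_sub_le_of_impact (F := energy M) (G := 0) (G' := 0) (D := univ) (c := 0)
    (fun _ _ => mem_univ _) (fun _ _ => mem_univ _)
    (fun r hr => by
      rw [(hz.admissible r (Ico_subset_Icc_self hr)).energy_impact hM (hz.no_simultaneous r hr)]
      simp)
    (fun _ _ => energy_free _) (fun _ _ => hasDerivAt_const _ _) (fun _ _ => le_rfl) t ht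
  simpa [sub_eq_zero] using h

end Functionals
section Drift

theorem isConfined_impact (hM : 0 < M) (hz : IsMotion M L s z)
    (hconf : ∀ t ∈ Icc 0 s, (z t).IsConfined M L R δ) :
    ∀ t ∈ Ico 0 s, ((z t).impact M L).IsConfined M L R δ := fun t ht =>
  (hconf t (Ico_subset_Icc_self ht)).impact hM (hz.no_simultaneous t ht)

theorem abs_leftInvariant_sub_le (hM : 1 ≤ M) (hR : 0 ≤ R) (hδ : 0 < δ) (hz : IsMotion M L s z)
    (hconf : ∀ t ∈ Icc 0 s, (z t).IsConfined M L R δ) : ∀ t ∈ Icc 0 s,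
      |(z t).leftInvariant M - (z 0).leftInvariant M| ≤
        m * (4 * R * L ^ 2) / M * (2 * (m + n) * R + (m + n) * (2 * R ^ 2 / δ) * t) := by
  intro t ht
  have hM₀ : 0 < M := zero_lt_one.trans_le hM
  set κ : ℝ := m * (4 * R * L ^ 2) / M
  have hκ₀ : 0 ≤ κ := by positivity
  have hdrift := hz.abs_sub_le_of_impact (F := leftInvariant M) (G := fun w => κ * w.virial L)
    (D := {w | w.IsConfined M L R δ}) (c := κ * ((m + n) * (2 * R ^ 2 / δ))) hconf
    (hz.isConfined_impact hM₀ hconf) ?_ (fun _ _ => leftInvariant_free _)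
    (fun w hw => hw.admissible.hasDerivAt_virial.const_mul κ) ?_ t ht
  · have hvirial : ∀ r ∈ Icc 0 s, |(z r).virial L| ≤ (m + n) * R :=
      fun r hr => (hconf r hr).abs_virial_le hM₀ hR
    have h₀ := (abs_le.1 (hvirial 0 ⟨le_rfl, ht.1.trans ht.2⟩)).2
    have h₁ := (abs_le.1 (hvirial t ht)).1
    calc _ ≤ κ * (z 0).virial L - κ * (z t).virial L + κ * ((m + n) * (2 * R ^ 2 / δ)) * t := hdrift
      _ = κ * ((z 0).virial L - (z t).virial L + (m + n) * (2 * R ^ 2 / δ) * t) := by ring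
      _ ≤ κ * (2 * (m + n) * R + (m + n) * (2 * R ^ 2 / δ) * t) := by
        gcongr
        linarith
  · intro r hr
    have hr' := Ico_subset_Icc_self hr
    rw [← mul_sub]
    exact ((hconf r hr').abs_leftInvariant_impact_sub_le hM hR (hz.no_simultaneous r hr)).trans
      (mul_le_mul_of_nonneg_left ((hconf r hr').admissible.abs_impact_P_sub_le hM₀) hκ₀)
  · intro w hw
    refine mul_le_mul_of_nonneg_left ?_ hκ₀
    rw [add_mul]
    exact add_le_add ((le_abs_self _).trans (IsConfined.abs_leftForce_le hM hR hδ hw))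
      ((le_abs_self _).trans (IsConfined.abs_leftForce_le hM hR hδ (IsConfined.reflect hw)))

theorem abs_leftInvariant_sub_action_le (hε : 0 < ε) (hε₁ : ε ≤ 1) (hεM : ε ^ 2 * M = 1)
    (hR : 0 ≤ R) (hδ : 0 < δ) (hsT : s ≤ T / ε) (hz : IsMotion M L s z)
    (hconf : ∀ t ∈ Icc 0 s, (z t).IsConfined M L R δ) : ∀ t ∈ Icc 0 s,
      |(z t).leftInvariant M - Real.pi ^ 2 * ∑ i, (z 0).actionLeft i ^ 2| ≤
        driftBound (m + n) L R δ T * ε := by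
  intro t ht
  have hM : 1 ≤ M := one_le_of_sq_mul_eq_one hε hε₁ hεM
  have hM₀ : 0 < M := zero_lt_one.trans_le hM
  have hz₀ := hconf 0 ⟨le_rfl, ht.1.trans ht.2⟩
  have hV : |(z 0).P / M| ≤ ε * R :=
    abs_velocity_le_of_energy_le hε.le hM₀ hεM.ge hR hz₀.energy_le
  have htT : t ≤ T / ε := ht.2.trans hsT
  have hm : (m : ℝ) ≤ m + n := le_add_of_nonneg_right n.cast_nonneg
  calc |(z t).leftInvariant M - Real.pi ^ 2 * ∑ i, (z 0).actionLeft i ^ 2|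
      ≤ m * (4 * R * L ^ 2) / M * (2 * (m + n) * R + (m + n) * (2 * R ^ 2 / δ) * t) +
          m * (4 * R * L ^ 2 * |(z 0).P / M|) :=
        (abs_sub_le _ _ _).trans (add_le_add (hz.abs_leftInvariant_sub_le hM hR hδ hconf t ht)
          (hz₀.abs_leftInvariant_sub_le hM hR))
    _ ≤ (m + n) * (4 * R * L ^ 2) / M *
          (2 * (m + n) * R + (m + n) * (2 * R ^ 2 / δ) * (T / ε)) +
          (m + n) * (4 * R * L ^ 2 * (ε * R)) := by
        have ht₀ := ht.1
        gcongr
    _ = (8 * (m + n) ^ 2 * R ^ 2 * L ^ 2 * (ε + R * T / δ) +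
          4 * (m + n) * R ^ 2 * L ^ 2) * ε := by
        rw [div_eq_mul_inv _ M, inv_eq_of_mul_eq_one_left hεM]
        field_simp
        ring
    _ ≤ driftBound (m + n) L R δ T * ε := by
        rw [driftBound, add_comm]
        gcongr

end Drift

end IsMotion
end PistonState

/-! ### Comparison with the averaged motion -/

namespace PistonState

variable {m n : ℕ} {ε M L R T δ s : ℝ}

section WellPrepared

variable {z₀ : PistonState m n}

theorem driftBound_nonneg {N : ℝ} (hN : 0 ≤ N) (hR : 0 ≤ R) (hT : 0 ≤ T) (hδ : 0 ≤ δ) :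
    0 ≤ driftBound N L R δ T := by
  unfold driftBound
  positivity

theorem pi_sq_mul_sum_actionRight_sq :
    Real.pi ^ 2 * ∑ j, z₀.actionRight L j ^ 2 = (L - z₀.X) ^ 2 * ∑ j, z₀.pr j ^ 2 := by
  simp only [← actionLeft_reflect, pi_sq_mul_sum_actionLeft_sq]
  simp only [reflect, neg_sq]

theorem IsConfined.pi_sq_mul_sum_actionLeft_sq_le (hM : 0 ≤ M) (h : z₀.IsConfined M L R δ) :
    Real.pi ^ 2 * ∑ i, z₀.actionLeft i ^ 2 ≤ L ^ 2 * R ^ 2 := by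
  have hP : 0 ≤ z₀.P ^ 2 / M := by positivity
  have hr : 0 ≤ ∑ j, z₀.pr j ^ 2 := by positivity
  have hE := h.energy_le
  unfold energy at hE
  rw [pi_sq_mul_sum_actionLeft_sq]
  gcongr
  · exact h.admissible.1.le
  · exact h.admissible.2.1.le
  · linarith

theorem IsConfined.lipschitzOnWith_averagedField (hM : 0 ≤ M) (hδ : 0 < δ)
    (h : z₀.IsConfined M L R δ) :
    LipschitzOnWith (1 + 6 * (L ^ 2 * R ^ 2) / δ ^ 4).toNNReal
      (averagedField L (Real.pi ^ 2 * ∑ i, z₀.actionLeft i ^ 2)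
        (Real.pi ^ 2 * ∑ j, z₀.actionRight L j ^ 2)) (Icc δ (L - δ) ×ˢ univ) := by
  have hα := h.pi_sq_mul_sum_actionLeft_sq_le hM
  have hβ := h.reflect.pi_sq_mul_sum_actionLeft_sq_le hM
  simp only [actionLeft_reflect] at hβ
  refine _root_.lipschitzOnWith_averagedField hδ (by positivity) (by positivity)
    (le_trans ?_ (Real.le_coe_toNNReal _))
  gcongr 1 + ?_ / δ ^ 4
  linarith

theorem Admissible.averagedEnergy_eq (hεM : ε ^ 2 * M = 1) (h : z₀.Admissible L) :
    averagedEnergy L (Real.pi ^ 2 * ∑ i, z₀.actionLeft i ^ 2)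
      (Real.pi ^ 2 * ∑ j, z₀.actionRight L j ^ 2) (z₀.X, ε * z₀.P) = z₀.energy M := by
  have hX := h.1
  have hX' := sub_pos.2 h.2.1
  rw [averagedEnergy, energy, pi_sq_mul_sum_actionLeft_sq, pi_sq_mul_sum_actionRight_sq,
    mul_div_cancel_left₀ _ (by positivity), mul_div_cancel_left₀ _ (by positivity), mul_pow,
    div_eq_mul_inv, inv_eq_of_mul_eq_one_left hεM, mul_comm (z₀.P ^ 2)]

/-- Initial states whose adiabatic invariants are so large that the piston cannot come closer than
`δ` to a wall up to the time `T / ε`. -/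
structure IsWellPrepared (ε M L R T δ : ℝ) (z₀ : PistonState m n) : Prop where
  confined : z₀.IsConfined M L R δ
  lt_left : 4 * (m + n + 1) * δ ^ 2 * R ^ 2 + driftBound (m + n) L R δ T * ε <
    Real.pi ^ 2 * ∑ i, z₀.actionLeft i ^ 2
  lt_right : 4 * (m + n + 1) * δ ^ 2 * R ^ 2 + driftBound (m + n) L R δ T * ε <
    Real.pi ^ 2 * ∑ j, z₀.actionRight L j ^ 2

namespace IsWellPrepared

theorem reflect (h : z₀.IsWellPrepared ε M L R T δ) :
    (z₀.reflect L).IsWellPrepared ε M L R T δ where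
  confined := h.confined.reflect
  lt_left := by simpa only [actionLeft_reflect, add_comm (n : ℝ)] using h.lt_right
  lt_right := by simpa only [actionRight_reflect, add_comm (n : ℝ)] using h.lt_left

theorem sq_mul_sq_lt_left (hε : 0 ≤ ε) (hR : 0 ≤ R) (hδ : 0 ≤ δ) (hT : 0 ≤ T)
    (h : z₀.IsWellPrepared ε M L R T δ) :
    δ ^ 2 * R ^ 2 < Real.pi ^ 2 * ∑ i, z₀.actionLeft i ^ 2 := by
  refine lt_of_le_of_lt ?_ h.lt_left
  have hD : 0 ≤ driftBound (m + n) L R δ T * ε :=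
    mul_nonneg (driftBound_nonneg (by positivity) hR hT hδ) hε
  have hmn : 0 ≤ (4 * (m + n) + 3) * (δ ^ 2 * R ^ 2) := by positivity
  linarith

theorem sq_mul_sq_lt_right (hε : 0 ≤ ε) (hR : 0 ≤ R) (hδ : 0 ≤ δ) (hT : 0 ≤ T)
    (h : z₀.IsWellPrepared ε M L R T δ) :
    δ ^ 2 * R ^ 2 < Real.pi ^ 2 * ∑ j, z₀.actionRight L j ^ 2 := by
  simpa only [actionLeft_reflect] using h.reflect.sq_mul_sq_lt_left hε hR hδ hT

theorem exists_isAveragedMotion (hε : 0 < ε) (hεM : ε ^ 2 * M = 1) (hR : 0 < R) (hδ : 0 < δ)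
    (hT : 0 ≤ T) (h : z₀.IsWellPrepared ε M L R T δ) :
    ∃ P X : ℝ → ℝ, P 0 = z₀.P ∧ X 0 = z₀.X ∧
      IsAveragedMotion ε L (∑ i, z₀.actionLeft i ^ 2) (∑ j, z₀.actionRight L j ^ 2)
        (T / ε) P X := by
  have hz₀ := h.confined.admissible
  obtain ⟨f, hf₀, hf⟩ := exists_forall_hasDerivWithinAt_averagedField ε hδ hR
    (div_nonneg hT hε.le) (h.sq_mul_sq_lt_left hε.le hR.le hδ.le hT)
    (h.sq_mul_sq_lt_right hε.le hR.le hδ.le hT) (p₀ := (z₀.X, ε * z₀.P)) ⟨hz₀.1, hz₀.2.1⟩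
    ((hz₀.averagedEnergy_eq hεM).trans_le h.confined.energy_le)
  refine ⟨fun t => (f t).2 / ε, fun t => (f t).1, ?_, ?_, (isAveragedMotion_iff hε.ne').2 ?_⟩
  · simp only [hf₀, mul_div_cancel_left₀ _ hε.ne']
  · simp only [hf₀]
  · simpa only [mul_div_cancel₀ _ hε.ne'] using hf

end IsWellPrepared

theorem isWellPrepared_of_bounds {a b : ℝ} (hεM : ε ^ 2 * M = 1) (ha : 0 ≤ a) (hδa : δ ≤ a)
    (hbR : b ^ 2 + 2 * b ≤ R ^ 2)
    (hsmall : 4 * (m + n + 1) * δ ^ 2 * R ^ 2 + driftBound (m + n) L R δ T * ε < a ^ 3)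
    (h : z₀.Admissible L) (hX : a ≤ z₀.X) (hX' : z₀.X ≤ L - a) (hP : |ε * z₀.P| ≤ b)
    (hl : a ≤ ∑ i, z₀.pl i ^ 2) (hl' : ∑ i, z₀.pl i ^ 2 ≤ b)
    (hr : a ≤ ∑ j, z₀.pr j ^ 2) (hr' : ∑ j, z₀.pr j ^ 2 ≤ b) :
    z₀.IsWellPrepared ε M L R T δ where
  confined := by
    refine ⟨h, le_trans ?_ hbR, hδa.trans hX, hX'.trans (sub_le_sub_left hδa L)⟩
    have hP' : z₀.P ^ 2 / M ≤ b ^ 2 := by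
      rw [div_eq_mul_inv, inv_eq_of_mul_eq_one_left hεM, mul_comm, ← mul_pow, ← sq_abs]
      gcongr
    rw [energy]
    linarith
  lt_left := by
    refine hsmall.trans_le ?_
    rw [pi_sq_mul_sum_actionLeft_sq, pow_succ]
    gcongr
  lt_right := by
    refine hsmall.trans_le ?_
    rw [pi_sq_mul_sum_actionRight_sq, pow_succ]
    have hX'' := le_sub_comm.1 hX'
    gcongr

theorem exists_eventually_isWellPrepared (m n : ℕ) (L T b : ℝ) {a : ℝ} (ha : 0 < a) :
    ∃ R > 0, ∃ δ > 0, ∀ᶠ ε in 𝓝[>] (0 : ℝ), ∀ z₀ : PistonState m n, z₀.Admissible L →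
      a ≤ z₀.X → z₀.X ≤ L - a → |ε * z₀.P| ≤ b →
      a ≤ ∑ i, z₀.pl i ^ 2 → ∑ i, z₀.pl i ^ 2 ≤ b →
      a ≤ ∑ j, z₀.pr j ^ 2 → ∑ j, z₀.pr j ^ 2 ≤ b →
      z₀.IsWellPrepared ε (1 / ε ^ 2) L R T δ := by
  have hR : 0 < |b| + 1 := by positivity
  have hbR : b ^ 2 + 2 * b ≤ (|b| + 1) ^ 2 := by
    rw [add_sq, sq_abs]
    linarith [le_abs_self b]
  have hδ : ∀ᶠ δ in 𝓝[>] (0 : ℝ), 4 * (m + n + 1) * δ ^ 2 * (|b| + 1) ^ 2 < a ^ 3 := by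
    exact (Continuous.tendsto' (by fun_prop) 0 0 (by simp)).eventually_lt_const (pow_pos ha 3)
      |>.filter_mono nhdsWithin_le_nhds
  obtain ⟨δ, hδ, hδ₀, hδa⟩ := (hδ.and (eventually_mem_set.2 (Ioc_mem_nhdsGT ha))).exists
  refine ⟨|b| + 1, hR, δ, hδ₀, ?_⟩
  have hε : ∀ᶠ ε in 𝓝[>] (0 : ℝ), 4 * (m + n + 1) * δ ^ 2 * (|b| + 1) ^ 2 +
      driftBound (m + n) L (|b| + 1) δ T * ε < a ^ 3 := by
    exact (Continuous.tendsto' (by fun_prop) 0 _ (by simp)).eventually_lt_const hδ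
      |>.filter_mono nhdsWithin_le_nhds
  filter_upwards [hε, self_mem_nhdsWithin] with ε hsmall hε₀ z₀
  exact isWellPrepared_of_bounds (mul_one_div_cancel (pow_pos hε₀ 2).ne') ha.le hδa hbR hsmall

end WellPrepared

/-- `slowStateBound N L R δ T * ε` bounds, up to the time `T / ε`, the distance of the corrected
slow variables of the exact motion from the averaged motion; `N` is the number of particles. -/
def slowStateBound (N L R δ T : ℝ) : ℝ :=
  (N * R + (N * R + (2 * N * L ^ 2 * R ^ 2 + 2 * driftBound N L R δ T) / δ ^ 3)) *
    Real.exp ((1 + 6 * (L ^ 2 * R ^ 2) / δ ^ 4) * T)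

/-- `comparisonBound N L R δ T * ε` bounds, up to the time `T / ε`, the distance of the exact motion
from the averaged motion in the variables `(X, ε P)`; `N` is the number of particles. -/
def comparisonBound (N L R δ T : ℝ) : ℝ := N * R + slowStateBound N L R δ T

namespace IsMotion

variable {z : ℝ → PistonState m n}

theorem lt_X_of_isConfined (hε : 0 < ε) (hε₁ : ε ≤ 1) (hεM : ε ^ 2 * M = 1) (hR : 0 ≤ R)
    (hδ : 0 < δ) (hsT : s ≤ T / ε) (hz : IsMotion M L s z) (hz₀ : (z 0).IsWellPrepared ε M L R T δ)
    (hconf : ∀ t ∈ Icc 0 s, (z t).IsConfined M L R δ) : ∀ t ∈ Icc 0 s, δ < (z t).X := by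
  intro t ht
  by_contra! hX
  have hM : 1 ≤ M := one_le_of_sq_mul_eq_one hε hε₁ hεM
  have hX₀ := (hconf t ht).admissible.1.le
  have hinvariant := (hconf t ht).leftInvariant_le hM hR
  have hdrift := abs_le.1 (hz.abs_leftInvariant_sub_action_le hε hε₁ hεM hR hδ hsT hconf t ht)
  have hle : m * (2 * R * (z t).X) ^ 2 ≤ 4 * (m + n + 1) * δ ^ 2 * R ^ 2 := by
    calc m * (2 * R * (z t).X) ^ 2 ≤ (m + n + 1) * (2 * R * δ) ^ 2 := by
          gcongr
          linarith [(n.cast_nonneg : (0 : ℝ) ≤ n)]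
      _ = 4 * (m + n + 1) * δ ^ 2 * R ^ 2 := by ring
  linarith [hz₀.lt_left]

theorem isConfined (hε : 0 < ε) (hε₁ : ε ≤ 1) (hεM : ε ^ 2 * M = 1) (hR : 0 ≤ R)
    (hδ : 0 < δ) (hsT : s ≤ T / ε) (hz : IsMotion M L s z)
    (hz₀ : (z 0).IsWellPrepared ε M L R T δ) : ∀ t ∈ Icc 0 s, (z t).IsConfined M L R δ := by
  have hM : 0 < M := zero_lt_one.trans_le (one_le_of_sq_mul_eq_one hε hε₁ hεM)
  have hconf : ∀ t ∈ Icc 0 s, (z t).X ∈ Icc δ (L - δ) → (z t).IsConfined M L R δ :=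
    fun t ht hX => ⟨hz.admissible t ht,
      (hz.energy_eq hM t ht).trans_le hz₀.confined.energy_le, hX.1, hX.2⟩
  have hX : ∀ t ∈ Icc 0 s, (z t).X ∈ Ioo δ (L - δ) := by
    refine forall_mem_Icc_of_bootstrap
      (hz.continuousOn (F := X) (fun _ _ => rfl) fun _ _ => hasDerivAt_free_X) isOpen_Ioo
      isClosed_Icc Ioo_subset_Icc_self ⟨hz₀.confined.le_X, hz₀.confined.X_le⟩ fun t ht hle => ?_
    have hconf' : ∀ r ∈ Icc 0 t, (z r).IsConfined M L R δ :=
      fun r hr => hconf r ⟨hr.1, hr.2.trans ht.2⟩ (hle r hr)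
    have hz' := hz.mono ht.2
    have htT := ht.2.trans hsT
    exact ⟨hz'.lt_X_of_isConfined hε hε₁ hεM hR hδ htT hz₀ hconf' t ⟨ht.1, le_rfl⟩,
      lt_sub_comm.1 (hz'.reflect.lt_X_of_isConfined hε hε₁ hεM hR hδ htT hz₀.reflect
        (fun r hr => (hconf' r hr).reflect) t ⟨ht.1, le_rfl⟩)⟩
  exact fun t ht => hconf t ht (Ioo_subset_Icc_self (hX t ht))

theorem abs_leftInvariant_impact_sub_action_le (hε : 0 < ε) (hε₁ : ε ≤ 1) (hεM : ε ^ 2 * M = 1)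
    (hR : 0 ≤ R) (hδ : 0 < δ) (hsT : s ≤ T / ε) (hz : IsMotion M L s z)
    (hconf : ∀ t ∈ Icc 0 s, (z t).IsConfined M L R δ) : ∀ t ∈ Ico 0 s,
      |((z t).impact M L).leftInvariant M - Real.pi ^ 2 * ∑ i, (z 0).actionLeft i ^ 2| ≤
        driftBound (m + n) L R δ T * ε := by
  intro t ht
  obtain ⟨u, hu, hzu⟩ := hz.exists_eq_free_impact ht
  rw [← leftInvariant_free (u - t), ← hzu]
  exact hz.abs_leftInvariant_sub_action_le hε hε₁ hεM hR hδ hsT hconf u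
    ⟨ht.1.trans hu.1.le, hu.2.le⟩

theorem dist_slowVelocity_impact_le (hε : 0 < ε) (hε₁ : ε ≤ 1) (hεM : ε ^ 2 * M = 1) (hR : 0 ≤ R)
    (hδ : 0 < δ) (hsT : s ≤ T / ε) (hz : IsMotion M L s z)
    (hconf : ∀ t ∈ Icc 0 s, (z t).IsConfined M L R δ) : ∀ t ∈ Ico 0 s,
      dist (((z t).impact M L).slowVelocity ε M L)
        (ε • averagedField L (Real.pi ^ 2 * ∑ i, (z 0).actionLeft i ^ 2)
          (Real.pi ^ 2 * ∑ j, (z 0).actionRight L j ^ 2) ((z t).slowState ε L)) ≤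
        ((m + n) * R + (2 * (m + n) * L ^ 2 * R ^ 2 + 2 * driftBound (m + n) L R δ T) / δ ^ 3) *
          ε ^ 2 := by
  intro t ht
  have hM : 1 ≤ M := one_le_of_sq_mul_eq_one hε hε₁ hεM
  rw [← (hz.admissible t (Ico_subset_Icc_self ht)).slowState_impact]
  refine (hz.isConfined_impact (zero_lt_one.trans_le hM) hconf t ht).dist_slowVelocity_le hε.le hM
    hεM hR hδ (hz.abs_leftInvariant_impact_sub_action_le hε hε₁ hεM hR hδ hsT hconf t ht) ?_
  simpa only [actionLeft_reflect, reflect_impact, add_comm (n : ℝ)] using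
    hz.reflect.abs_leftInvariant_impact_sub_action_le hε hε₁ hεM hR hδ hsT
      (fun r hr => (hconf r hr).reflect) t ht

theorem dist_slowState_averaged_le (hε : 0 < ε) (hε₁ : ε ≤ 1) (hεM : ε ^ 2 * M = 1) (hR : 0 ≤ R)
    (hδ : 0 < δ) (hT : 0 ≤ T) (hsT : s ≤ T / ε) (hz : IsMotion M L s z)
    (hz₀ : (z 0).IsWellPrepared ε M L R T δ) {g : ℝ → ℝ × ℝ} (hg₀ : g 0 = ((z 0).X, ε * (z 0).P))
    (hg : ∀ t ∈ Icc 0 s, (g t).1 ∈ Ioo 0 L ∧ HasDerivWithinAt g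
      (ε • averagedField L (Real.pi ^ 2 * ∑ i, (z 0).actionLeft i ^ 2)
        (Real.pi ^ 2 * ∑ j, (z 0).actionRight L j ^ 2) (g t)) (Icc 0 s) t) :
    ∀ t ∈ Icc 0 s, dist ((z t).slowState ε L) (g t) ≤
      slowStateBound (m + n) L R δ T * ε := by
  intro t ht
  have hM : 0 < M := zero_lt_one.trans_le (one_le_of_sq_mul_eq_one hε hε₁ hεM)
  have hD := driftBound_nonneg (L := L) (by positivity : (0 : ℝ) ≤ m + n) hR hT hδ.le
  have hK : 1 ≤ 1 + 6 * (L ^ 2 * R ^ 2) / δ ^ 4 := le_add_of_nonneg_right (by positivity)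
  have hzconf := hz.isConfined hε hε₁ hεM hR hδ hsT hz₀
  have hgconf := mem_Ioo_and_abs_le_of_hasDerivWithinAt_averagedField hR
    (hz₀.sq_mul_sq_lt_left hε.le hR hδ.le hT) (hz₀.sq_mul_sq_lt_right hε.le hR hδ.le hT)
    (by rw [hg₀, hz₀.confined.admissible.averagedEnergy_eq hεM]; exact hz₀.confined.energy_le) hg
  have hinitial : dist ((z 0).slowState ε L) (g 0) ≤ (m + n) * R * ε :=
    hg₀ ▸ hz₀.confined.dist_slowState_le hε.le hM hR
  have hcompare := dist_le_of_slow_approx_trajectory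
    (hz₀.confined.lipschitzOnWith_averagedField hM.le hδ) (Real.one_le_toNNReal.2 hK) hε
    (by positivity) (by positivity) hsT
    (hz.continuousOn (fun _ hw => hw.slowState_impact) fun _ hw => hw.hasDerivAt_slowState)
    (fun r hr => have hr' := hz.admissible r (Ico_subset_Icc_self hr)
      hz.hasDerivWithinAt_Ici hr hr'.slowState_impact hr'.impact.hasDerivAt_slowState)
    (hz.dist_slowVelocity_impact_le hε hε₁ hεM hR hδ hsT hzconf)
    (fun r hr => have hr' := hzconf r (Ico_subset_Icc_self hr)
      ⟨⟨hr'.le_X, hr'.X_le⟩, mem_univ _⟩)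
    (fun r hr => (hg r hr).2)
    (fun r hr => ⟨Ioo_subset_Icc_self (hgconf r (Ico_subset_Icc_self hr)).1, mem_univ _⟩)
    hinitial t ht
  rwa [Real.coe_toNNReal _ (zero_le_one.trans hK)] at hcompare

theorem dist_averaged_le (hε : 0 < ε) (hε₁ : ε ≤ 1) (hεM : ε ^ 2 * M = 1) (hR : 0 ≤ R)
    (hδ : 0 < δ) (hT : 0 ≤ T) (hsT : s ≤ T / ε) (hz : IsMotion M L s z)
    (hz₀ : (z 0).IsWellPrepared ε M L R T δ) {P X : ℝ → ℝ} (hP : P 0 = (z 0).P)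
    (hX : X 0 = (z 0).X)
    (h : IsAveragedMotion ε L (∑ i, (z 0).actionLeft i ^ 2) (∑ j, (z 0).actionRight L j ^ 2)
      s P X) :
    ∀ t ∈ Icc 0 s, dist ((z t).X, ε * (z t).P) (X t, ε * P t) ≤
      comparisonBound (m + n) L R δ T * ε := by
  intro t ht
  have hM : 0 < M := zero_lt_one.trans_le (one_le_of_sq_mul_eq_one hε hε₁ hεM)
  rw [comparisonBound, add_mul]
  exact (dist_triangle_left _ _ ((z t).slowState ε L)).trans (add_le_add
    ((hz.isConfined hε hε₁ hεM hR hδ hsT hz₀ t ht).dist_slowState_le hε.le hM hR)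
    (hz.dist_slowState_averaged_le hε hε₁ hεM hR hδ hT hsT hz₀ (g := fun t => (X t, ε * P t))
      (by rw [hP, hX])
      ((isAveragedMotion_iff hε.ne').1 h) t ht))

end IsMotion

end PistonState

end

theorem mainTheorem8 (m n : ℕ) (L T a b : ℝ) (hL : 0 < L) (hT : 0 < T) (ha : 0 < a) :
    ∃ ε₀ > 0, ∃ C > 0, ∀ ε : ℝ, 0 < ε → ε < ε₀ →
      ∀ z₀ : PistonState m n, z₀.Admissible L →
        a ≤ z₀.X → z₀.X ≤ L - a → |ε * z₀.P| ≤ b →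
        a ≤ ∑ i, z₀.pl i ^ 2 → ∑ i, z₀.pl i ^ 2 ≤ b →
        a ≤ ∑ j, z₀.pr j ^ 2 → ∑ j, z₀.pr j ^ 2 ≤ b →
        (∃ P X : ℝ → ℝ, P 0 = z₀.P ∧ X 0 = z₀.X ∧
          IsAveragedMotion ε L (∑ i, z₀.actionLeft i ^ 2) (∑ j, z₀.actionRight L j ^ 2)
            (T / ε) P X) ∧
        ∀ s : ℝ, 0 ≤ s → s ≤ T / ε →
          ∀ z : ℝ → PistonState m n, z 0 = z₀ → PistonState.IsMotion (1 / ε ^ 2) L s z →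
          ∀ P X : ℝ → ℝ, P 0 = z₀.P → X 0 = z₀.X →
            IsAveragedMotion ε L (∑ i, z₀.actionLeft i ^ 2) (∑ j, z₀.actionRight L j ^ 2) s P X →
            ∀ t ∈ Icc 0 s,
              |ε * (z t).P - ε * P t| ≤ C * ε ∧ |(z t).X - X t| ≤ C * ε := by
  obtain ⟨R, hR, δ, hδ, hprepared⟩ := PistonState.exists_eventually_isWellPrepared m n L T b ha
  obtain ⟨ε₀, hε₀, hIoo⟩ := mem_nhdsGT_iff_exists_Ioo_subset.1
    (hprepared.and (eventually_mem_set.2 (Ioo_mem_nhdsGT zero_lt_one)))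
  refine ⟨ε₀, hε₀, max (PistonState.comparisonBound (m + n) L R δ T) 1,
    lt_max_of_lt_right one_pos, ?_⟩
  intro ε hε hεε₀ z₀ hz₀ hX hX' hP hl hl' hr hr'
  obtain ⟨hprepared, -, hε₁⟩ := hIoo ⟨hε, hεε₀⟩
  have hεM : ε ^ 2 * (1 / ε ^ 2) = 1 := mul_one_div_cancel (pow_pos hε 2).ne'
  have hwell := hprepared z₀ hz₀ hX hX' hP hl hl' hr hr'
  refine ⟨hwell.exists_isAveragedMotion hε hεM hR hδ hT.le, ?_⟩
  rintro s - hsT z rfl hz P X hP₀ hX₀ h t ht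
  have hdist := (hz.dist_averaged_le hε hε₁.le hεM hR.le hδ hT.le hsT hwell hP₀ hX₀ h t ht).trans
    (mul_le_mul_of_nonneg_right (le_max_left _ 1) hε.le)
  exact ⟨(le_max_right _ _).trans hdist, (le_max_left _ _).trans hdist⟩
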